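/- Let $\mathbb F$ be a field of characteristic zero. Let $\boxtimes$ be the tetrahedron Lie algebra over $\mathbb F$: it has generators $x_{ij}$ ($i,j\in\{0,1,2,3\}$, $i\ne j$) and the relations - $x_{ij}+x_{ji}=0$ for distinct $i,j$; - $[x_{ij},x_{jk}]=2x_{ij}+2x_{jk}$ for mutually distinct $i,j,k$; - $[x_{ij},[x_{ij},[x_{ij},x_{kh}]]]=4[x_{ij},x_{kh}]$ for mutually distinct $h,i,j,k$. For distinct $i,j$ let $X_{ij}$ be the subspace of $x_{ij}$-like elements of $\boxtimes$, that is, the elements $\xi$ with $[x_{ij},\xi]=0$ and $[x_{kh},[x_{kh},[x_{kh},\xi]]]=4[x_{kh},\xi]$ whenever $h,i,j,k$ are mutually distinct. Let $O$ be the Lie subalgebra of $\boxtimes$ generated by $x_{12}$ and $x_{03}$ (an Onsager subalgebra). The symmetric group $S_4$ on $\{0,1,2,3\}$ acts on $\boxtimes$ by automorphisms with $\beta(x_{ij})=x_{\beta(i)\beta(j)}$. Put $\rho=(12)(03)$, $\tau=(12)$, and let $G$ be the subgroup of $S_4$ generated by $\rho,\tau$. Then the vector space $O$ satisfies $$\begin{aligned}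 O&=(X_{03}\cap O)+(X_{31}\cap O)+(X_{12}\cap O)&&[0312]\\ &=(X_{30}\cap O)+(X_{02}\cap O)+(X_{21}\cap O)&&[3021]\\ &=(X_{03}\cap O)+(X_{32}\cap O)+(X_{21}\cap O)&&[0321]\\ &=(X_{30}\cap O)+(X_{01}\cap O)+(X_{12}\cap O)&&[3012] \end{aligned}$$ and each of these four sums is direct. Moreover, $G\cong\mathbb Z_2\times\mathbb Z_2$, $\beta(O)=O$ for all $\beta\in G$, and $\rho$, $\tau$, $\rho\tau$ send the three summands of $[0312]$, in the order displayed, onto the three summands of $[3021]$, $[0321]$, $[3012]$, respectively. The same four direct sum decompositions hold in the three-point $\mathfrak{sl}_2$ loop algebra. Precisely, let $x=2e-h$, $y=-2f-h$, $z=h$ be the equitable basis of $\mathfrak{sl}_2$, let $\mathcal A=\mathbb F[t,t^{-1},(t-1)^{-1}]$, $t'=1-t^{-1}$, $t''=(1-t)^{-1}$, and let $\sigma:\boxtimes\to\mathfrak{sl}_2\otimes\mathcal A$ be the Lie algebra homomorphism that sends $$\begin{aligned} x_{12}&\mapsto x\otimes1, & x_{03}&\mapsto y\otimes t+z\otimes(t-1),\\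 x_{23}&\mapsto y\otimes1, & x_{01}&\mapsto z\otimes t'+x\otimes(t'-1),\\ x_{31}&\mapsto z\otimes1, & x_{02}&\mapsto x\otimes t''+y\otimes(t''-1). \end{aligned}$$ If every $X_{ij}$ is replaced by its image $\sigma(X_{ij})$ and $O$ by $\sigma(O)$, then the four displayed equalities still hold, and each of the sums is direct. -/

import Mathlib

open scoped TensorProduct Polynomial

noncomputable section

namespace Tetrahedron

variable (F : Type*) [Field F]

/-! ### The tetrahedron algebra by generators and relations -/

/-- The index set of the generators: ordered pairs of distinct elements of `{0, 1, 2, 3}`. -/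
abbrev Gen : Type := {p : Fin 4 × Fin 4 // p.1 ≠ p.2}

/-- The free generator with index `(i, j)`. -/
def freeGen (i j : Fin 4) (hij : i ≠ j) : FreeLieAlgebra F Gen :=
  FreeLieAlgebra.of F (⟨(i, j), hij⟩ : Gen)

/-- The defining relators of the tetrahedron algebra. -/
inductive Relator : FreeLieAlgebra F Gen → Prop
  | skew (i j : Fin 4) (hij : i ≠ j) :
      Relator (freeGen F i j hij + freeGen F j i hij.symm)
  | triangle (i j k : Fin 4) (hij : i ≠ j) (hjk : j ≠ k) (hik : i ≠ k) :
      Relator (⁅freeGen F i j hij, freeGen F j k hjk⁆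
        - ((2 : F) • freeGen F i j hij + (2 : F) • freeGen F j k hjk))
  | dolanGrady (h i j k : Fin 4) (hij : i ≠ j) (hkh : k ≠ h)
      (hhi : h ≠ i) (hhj : h ≠ j) (hki : k ≠ i) (hkj : k ≠ j) :
      Relator (⁅freeGen F i j hij, ⁅freeGen F i j hij, ⁅freeGen F i j hij, freeGen F k h hkh⁆⁆⁆
        - (4 : F) • ⁅freeGen F i j hij, freeGen F k h hkh⁆)

/-- The ideal of the free Lie algebra generated by the relators. -/
def relIdeal : LieIdeal F (FreeLieAlgebra F Gen) :=
  LieSubmodule.lieSpan F (FreeLieAlgebra F Gen) {r | Relator F r}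

/-- The tetrahedron algebra. -/
def Tet : Type _ := FreeLieAlgebra F Gen ⧸ relIdeal F

instance : LieRing (Tet F) := inferInstanceAs (LieRing (FreeLieAlgebra F Gen ⧸ relIdeal F))

instance : LieAlgebra F (Tet F) :=
  inferInstanceAs (LieAlgebra F (FreeLieAlgebra F Gen ⧸ relIdeal F))

/-- The quotient homomorphism from the free Lie algebra. -/
def toTet : FreeLieAlgebra F Gen →ₗ⁅F⁆ Tet F where
  toFun a := (LieSubmodule.Quotient.mk a : FreeLieAlgebra F Gen ⧸ relIdeal F)
  map_add' _ _ := rfl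
  map_smul' _ _ := rfl
  map_lie' := rfl

/-- The standard generator `x_{ij}`. -/
def x (i j : Fin 4) (hij : i ≠ j := by decide) : Tet F := toTet F (freeGen F i j hij)

/-- The homomorphism out of the tetrahedron algebra given by a Lie algebra homomorphism on the
free Lie algebra that kills the relators. -/
def descend {L : Type*} [LieRing L] [LieAlgebra F L] (f : FreeLieAlgebra F Gen →ₗ⁅F⁆ L)
    (hf : ∀ r, Relator F r → f r = 0) : Tet F →ₗ⁅F⁆ L :=
  have hle : relIdeal F ≤ f.ker := LieSubmodule.lieSpan_le.2 fun r hr => by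
    simpa using hf r hr
  { Submodule.liftQ (relIdeal F).toSubmodule (f : FreeLieAlgebra F Gen →ₗ[F] L)
      (fun r hr => by simpa using hle hr) with
    map_lie' := by
      intro a b
      obtain ⟨a, rfl⟩ := LieSubmodule.Quotient.surjective_mk' (relIdeal F) a
      obtain ⟨b, rfl⟩ := LieSubmodule.Quotient.surjective_mk' (relIdeal F) b
      exact f.map_lie a b }

theorem descend_toTet {L : Type*} [LieRing L] [LieAlgebra F L] (f : FreeLieAlgebra F Gen →ₗ⁅F⁆ L)
    (hf : ∀ r, Relator F r → f r = 0) (a : FreeLieAlgebra F Gen) :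
    descend F f hf (toTet F a) = f a := rfl

theorem toTet_eq_zero {r : FreeLieAlgebra F Gen} (hr : Relator F r) : toTet F r = 0 :=
  (LieSubmodule.Quotient.mk_eq_zero' (N := relIdeal F)).2 (LieSubmodule.subset_lieSpan hr)

theorem tet_hom_ext {L : Type*} [LieRing L] [LieAlgebra F L] {f g : Tet F →ₗ⁅F⁆ L}
    (h : ∀ (i j : Fin 4) (hij : i ≠ j), f (x F i j hij) = g (x F i j hij)) : f = g := by
  have hcomp : f.comp (toTet F) = g.comp (toTet F) :=
    FreeLieAlgebra.hom_ext (fun p => h p.1.1 p.1.2 p.2)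
  ext a
  obtain ⟨b, rfl⟩ := LieSubmodule.Quotient.surjective_mk' (relIdeal F) a
  exact LieHom.congr_fun hcomp b

/-! ### The action of the symmetric group -/

/-- The endomorphism of the tetrahedron algebra sending `x_{ij}` to `x_{β(i)β(j)}`. -/
def permHom (β : Equiv.Perm (Fin 4)) : Tet F →ₗ⁅F⁆ Tet F :=
  descend F
    (FreeLieAlgebra.lift F fun p : Gen => x F (β p.1.1) (β p.1.2) (β.injective.ne p.2)) <| by
    intro r hr
    have key : ∀ (i j : Fin 4) (hij : i ≠ j),
        FreeLieAlgebra.lift F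
          (fun p : Gen => x F (β p.1.1) (β p.1.2) (β.injective.ne p.2)) (freeGen F i j hij)
          = toTet F (freeGen F (β i) (β j) (β.injective.ne hij)) :=
      fun i j hij => FreeLieAlgebra.lift_of_apply _ _
    cases hr with
    | skew i j hij =>
      simp only [map_add, key]
      rw [← map_add]
      exact toTet_eq_zero F (.skew _ _ _)
    | triangle i j k hij hjk hik =>
      simp only [map_add, map_sub, map_smul, LieHom.map_lie, key]
      simp only [← map_add, ← map_sub, ← map_smul, ← LieHom.map_lie]
      exact toTet_eq_zero F (.triangle _ _ _ _ _ (β.injective.ne hik))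
    | dolanGrady h i j k hij hkh hhi hhj hki hkj =>
      simp only [map_sub, map_smul, LieHom.map_lie, key]
      simp only [← map_sub, ← map_smul, ← LieHom.map_lie]
      exact toTet_eq_zero F (.dolanGrady _ _ _ _ _ _ (β.injective.ne hhi) (β.injective.ne hhj)
        (β.injective.ne hki) (β.injective.ne hkj))

theorem permHom_x (β : Equiv.Perm (Fin 4)) (i j : Fin 4) (hij : i ≠ j) :
    permHom F β (x F i j hij) = x F (β i) (β j) (β.injective.ne hij) :=
  FreeLieAlgebra.lift_of_apply _ _

theorem permHom_comp (β γ : Equiv.Perm (Fin 4)) :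
    (permHom F β).comp (permHom F γ) = permHom F (β * γ) :=
  tet_hom_ext F fun i j hij => by
    simp only [LieHom.comp_apply, permHom_x, Equiv.Perm.mul_apply]

theorem permHom_one : permHom F 1 = LieHom.id :=
  tet_hom_ext F fun i j hij => by
    simp only [permHom_x, Equiv.Perm.one_apply, LieHom.id_apply]

/-- The automorphism of the tetrahedron algebra by which `β ∈ S₄` acts. -/
def permAut (β : Equiv.Perm (Fin 4)) : Tet F ≃ₗ⁅F⁆ Tet F :=
  { permHom F β with
    invFun := permHom F β⁻¹
    left_inv := fun a => by
      have := LieHom.congr_fun (permHom_comp F β⁻¹ β) a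
      simpa [permHom_one] using this
    right_inv := fun a => by
      have := LieHom.congr_fun (permHom_comp F β β⁻¹) a
      simpa [permHom_one] using this }

/-- `ρ = (12)(03)`. -/
def rho : Equiv.Perm (Fin 4) := Equiv.swap 1 2 * Equiv.swap 0 3

/-- `τ = (12)`. -/
def tau : Equiv.Perm (Fin 4) := Equiv.swap 1 2

/-- The subgroup `G` of `S₄` generated by `ρ` and `τ`. -/
def kleinG : Subgroup (Equiv.Perm (Fin 4)) := Subgroup.closure {rho, tau}

/-! ### Like elements, the Onsager subalgebra and path-shaped families -/

/-- The subspace `X_{ij}` of `x_{ij}`-like elements. -/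
def X (i j : Fin 4) (hij : i ≠ j := by decide) : Submodule F (Tet F) where
  carrier := {ξ | ⁅x F i j hij, ξ⁆ = 0 ∧
    ∀ (h k : Fin 4) (hkh : k ≠ h), h ≠ i → h ≠ j → k ≠ i → k ≠ j →
      ⁅x F k h hkh, ⁅x F k h hkh, ⁅x F k h hkh, ξ⁆⁆⁆ = (4 : F) • ⁅x F k h hkh, ξ⁆}
  add_mem' := by
    rintro a b ⟨ha, ha'⟩ ⟨hb, hb'⟩
    refine ⟨by rw [lie_add, ha, hb, add_zero], fun h k hkh h1 h2 h3 h4 => ?_⟩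
    simp only [lie_add, ha' h k hkh h1 h2 h3 h4, hb' h k hkh h1 h2 h3 h4, smul_add]
  zero_mem' := by simp
  smul_mem' := by
    rintro c a ⟨ha, ha'⟩
    refine ⟨by rw [lie_smul, ha, smul_zero], fun h k hkh h1 h2 h3 h4 => ?_⟩
    simp only [lie_smul, ha' h k hkh h1 h2 h3 h4]
    rw [smul_comm]

/-- The Onsager subalgebra `O` generated by `A = x_{12}` and `B = x_{03}`. -/
def onsager : LieSubalgebra F (Tet F) := LieSubalgebra.lieSpan F (Tet F) {x F 1 2, x F 0 3}

/-- The three subspaces `X_{kh} ∩ O`, `X_{hi} ∩ O`, `X_{ij} ∩ O`, in this order. -/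
def pathSummands (k h i j : Fin 4) (hkh : k ≠ h := by decide) (hhi : h ≠ i := by decide)
    (hij : i ≠ j := by decide) : Fin 3 → Submodule F (Tet F) :=
  ![X F k h hkh ⊓ (onsager F).toSubmodule, X F h i hhi ⊓ (onsager F).toSubmodule,
    X F i j hij ⊓ (onsager F).toSubmodule]

/-- The subspace `W` is the (internal) direct sum of the three subspaces `U 0`, `U 1`, `U 2`. -/
def IsDirectSum {K V : Type*} [Field K] [AddCommGroup V] [Module K V] (W : Submodule K V)
    (U : Fin 3 → Submodule K V) : Prop :=
  (∀ m, U m ≤ W) ∧ DirectSum.IsInternal fun m => (U m).submoduleOf W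

/-! ### The three-point `sl₂` loop algebra -/

/-- The Lie algebra `sl₂`. -/
def Sl2 : Type _ := LieAlgebra.SpecialLinear.sl (Fin 2) F

instance : LieRing (Sl2 F) := inferInstanceAs (LieRing (LieAlgebra.SpecialLinear.sl (Fin 2) F))

instance : LieAlgebra F (Sl2 F) :=
  inferInstanceAs (LieAlgebra F (LieAlgebra.SpecialLinear.sl (Fin 2) F))

/-- A trace-zero matrix as an element of `sl₂`. -/
def slMk (M : Matrix (Fin 2) (Fin 2) F) (hM : M.trace = 0) : Sl2 F :=
  (⟨M, hM⟩ : LieAlgebra.SpecialLinear.sl (Fin 2) F)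

/-- The standard basis elements `e`, `f`, `h` of `sl₂`. -/
def slE : Sl2 F := slMk F !![0, 1; 0, 0] (by simp [Matrix.trace_fin_two])
/-- See `slE`. -/
def slF : Sl2 F := slMk F !![0, 0; 1, 0] (by simp [Matrix.trace_fin_two])
/-- See `slE`. -/
def slH : Sl2 F := slMk F !![1, 0; 0, -1] (by simp [Matrix.trace_fin_two])

/-- The equitable basis `x = 2e - h`, `y = -2f - h`, `z = h` of `sl₂`. -/
def eqX : Sl2 F := (2 : F) • slE F - slH F
/-- See `eqX`. -/
def eqY : Sl2 F := -((2 : F) • slF F) - slH F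
/-- See `eqX`. -/
def eqZ : Sl2 F := slH F

/-- The algebra `F[t, t⁻¹, (t-1)⁻¹]`. -/
def LaurentA : Type _ := Localization.Away (Polynomial.X * (Polynomial.X - 1) : F[X])

instance : CommRing (LaurentA F) :=
  inferInstanceAs (CommRing (Localization.Away (Polynomial.X * (Polynomial.X - 1) : F[X])))

instance : Algebra F[X] (LaurentA F) :=
  inferInstanceAs (Algebra F[X] (Localization.Away (Polynomial.X * (Polynomial.X - 1) : F[X])))

instance : Algebra F (LaurentA F) :=
  inferInstanceAs (Algebra F (Localization.Away (Polynomial.X * (Polynomial.X - 1) : F[X])))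

instance : IsScalarTower F F[X] (LaurentA F) :=
  inferInstanceAs
    (IsScalarTower F F[X] (Localization.Away (Polynomial.X * (Polynomial.X - 1) : F[X])))

instance : IsLocalization.Away (Polynomial.X * (Polynomial.X - 1) : F[X]) (LaurentA F) :=
  inferInstanceAs (IsLocalization.Away (Polynomial.X * (Polynomial.X - 1) : F[X])
    (Localization.Away (Polynomial.X * (Polynomial.X - 1) : F[X])))

/-- The element `t`. -/
def t : LaurentA F := algebraMap F[X] (LaurentA F) Polynomial.X

/-- `t' = 1 - t⁻¹`; the element `t` is a unit. -/
def t' : LaurentA F := 1 - Ring.inverse (t F)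

/-- `t'' = (1 - t)⁻¹`; the element `1 - t` is a unit. -/
def t'' : LaurentA F := Ring.inverse (1 - t F)

/-- The three-point loop algebra, with bracket `[a ⊗ u, b ⊗ v] = ab ⊗ [u, v]`
(the commutative factor is written on the left). -/
abbrev Loop : Type _ := LaurentA F ⊗[F] Sl2 F

/-- The images of the standard generators in the loop algebra (and `0` when `i = j`). -/
def loopGen : Fin 4 → Fin 4 → Loop F
  | 1, 2 => 1 ⊗ₜ eqX F
  | 2, 1 => -(1 ⊗ₜ eqX F)
  | 2, 3 => 1 ⊗ₜ eqY F
  | 3, 2 => -(1 ⊗ₜ eqY F)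
  | 3, 1 => 1 ⊗ₜ eqZ F
  | 1, 3 => -(1 ⊗ₜ eqZ F)
  | 0, 3 => t F ⊗ₜ eqY F + (t F - 1) ⊗ₜ eqZ F
  | 3, 0 => -(t F ⊗ₜ eqY F + (t F - 1) ⊗ₜ eqZ F)
  | 0, 1 => t' F ⊗ₜ eqZ F + (t' F - 1) ⊗ₜ eqX F
  | 1, 0 => -(t' F ⊗ₜ eqZ F + (t' F - 1) ⊗ₜ eqX F)
  | 0, 2 => t'' F ⊗ₜ eqX F + (t'' F - 1) ⊗ₜ eqY F
  | 2, 0 => -(t'' F ⊗ₜ eqX F + (t'' F - 1) ⊗ₜ eqY F)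
  | _, _ => 0

theorem isUnit_t : IsUnit (t F) ∧ IsUnit (1 - t F) := by
  have h := IsLocalization.Away.algebraMap_isUnit (S := LaurentA F)
    (Polynomial.X * (Polynomial.X - 1) : F[X])
  rw [map_mul, map_sub, map_one] at h
  refine ⟨isUnit_of_mul_isUnit_left h, ?_⟩
  have h2 := (isUnit_of_mul_isUnit_right h).neg
  rwa [neg_sub] at h2

/-- The underlying matrix of an element of `sl₂`. -/
def slVal (u : Sl2 F) : Matrix (Fin 2) (Fin 2) F :=
  (show LieAlgebra.SpecialLinear.sl (Fin 2) F from u).val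

theorem slVal_injective : Function.Injective (slVal F) := Subtype.val_injective

theorem slVal_add (u v : Sl2 F) : slVal F (u + v) = slVal F u + slVal F v := rfl

theorem slVal_sub (u v : Sl2 F) : slVal F (u - v) = slVal F u - slVal F v := rfl

theorem slVal_neg (u : Sl2 F) : slVal F (-u) = -slVal F u := rfl

theorem slVal_smul (c : F) (u : Sl2 F) : slVal F (c • u) = c • slVal F u := rfl

theorem slVal_lie (u v : Sl2 F) :
    slVal F ⁅u, v⁆ = slVal F u * slVal F v - slVal F v * slVal F u := rfl

theorem slVal_mk (M : Matrix (Fin 2) (Fin 2) F) (hM : M.trace = 0) : slVal F (slMk F M hM) = M :=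
  rfl

theorem eq_lie : ⁅eqX F, eqY F⁆ = (2 : F) • eqX F + (2 : F) • eqY F ∧
    ⁅eqY F, eqZ F⁆ = (2 : F) • eqY F + (2 : F) • eqZ F ∧
    ⁅eqZ F, eqX F⁆ = (2 : F) • eqZ F + (2 : F) • eqX F := by
  refine ⟨?_, ?_, ?_⟩ <;>
  · apply slVal_injective F
    simp only [eqX, eqY, eqZ, slE, slF, slH, slVal_lie, slVal_add, slVal_sub, slVal_neg,
      slVal_smul, slVal_mk]
    ext i j
    fin_cases i <;> fin_cases j <;> simp <;> ring

/-- The element of the loop algebra with coordinates `a, b, c` in the equitable basis. -/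
def comb (a b c : LaurentA F) : Loop F := a ⊗ₜ eqX F + b ⊗ₜ eqY F + c ⊗ₜ eqZ F

theorem comb_lie (a b c a' b' c' : LaurentA F) :
    ⁅comb F a b c, comb F a' b' c'⁆ =
      comb F (2 * (a * b' - b * a') + 2 * (c * a' - a * c'))
        (2 * (a * b' - b * a') + 2 * (b * c' - c * b'))
        (2 * (b * c' - c * b') + 2 * (c * a' - a * c')) := by
  obtain ⟨h1, h2, h3⟩ := eq_lie F
  have h1' : ⁅eqY F, eqX F⁆ = -((2 : F) • eqX F + (2 : F) • eqY F) := by rw [← h1, lie_skew]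
  have h2' : ⁅eqZ F, eqY F⁆ = -((2 : F) • eqY F + (2 : F) • eqZ F) := by rw [← h2, lie_skew]
  have h3' : ⁅eqX F, eqZ F⁆ = -((2 : F) • eqZ F + (2 : F) • eqX F) := by rw [← h3, lie_skew]
  have two : ∀ (a : LaurentA F) (u : Sl2 F), (2 * a) ⊗ₜ[F] u = (2 : F) • (a ⊗ₜ[F] u) := by
    intro a u
    rw [two_mul, TensorProduct.add_tmul, two_smul]
  simp only [comb, lie_add, add_lie, LieAlgebra.ExtendScalars.bracket_tmul, lie_self, h1, h2, h3,
    h1', h2', h3', TensorProduct.add_tmul, TensorProduct.sub_tmul, two, TensorProduct.tmul_add,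
    TensorProduct.tmul_neg, TensorProduct.tmul_smul, TensorProduct.tmul_zero, smul_sub]
  abel

theorem comb_neg (a b c : LaurentA F) : -comb F a b c = comb F (-a) (-b) (-c) := by
  simp only [comb, TensorProduct.neg_tmul]
  abel

theorem comb_add (a b c a' b' c' : LaurentA F) :
    comb F a b c + comb F a' b' c' = comb F (a + a') (b + b') (c + c') := by
  simp only [comb, TensorProduct.add_tmul]
  abel

theorem comb_two (a b c : LaurentA F) :
    (2 : F) • comb F a b c = comb F (2 * a) (2 * b) (2 * c) := by
  rw [two_smul, comb_add]
  simp only [two_mul]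

theorem comb_four (a b c : LaurentA F) :
    (4 : F) • comb F a b c = comb F (4 * a) (4 * b) (4 * c) := by
  rw [show (4 : F) = 2 * 2 by norm_num, mul_smul, comb_two, comb_two]
  congr 1 <;> ring

theorem comb_dolanGrady (a b c a' b' c' : LaurentA F)
    (hq : a ^ 2 + b ^ 2 + c ^ 2 - 2 * a * b - 2 * b * c - 2 * c * a = 1) :
    ⁅comb F a b c, ⁅comb F a b c, ⁅comb F a b c, comb F a' b' c'⁆⁆⁆
      = (4 : F) • ⁅comb F a b c, comb F a' b' c'⁆ := by
  simp only [comb_lie, comb_four]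
  congr 1
  · linear_combination (4 * (2 * (a * b' - b * a') + 2 * (c * a' - a * c'))) * hq
  · linear_combination (4 * (2 * (a * b' - b * a') + 2 * (b * c' - c * b'))) * hq
  · linear_combination (4 * (2 * (b * c' - c * b') + 2 * (c * a' - a * c'))) * hq

theorem t_mul : t F * Ring.inverse (t F) = 1 ∧ (1 - t F) * Ring.inverse (1 - t F) = 1 :=
  ⟨Ring.mul_inverse_cancel _ (isUnit_t F).1, Ring.mul_inverse_cancel _ (isUnit_t F).2⟩

theorem loopGen_values :
    loopGen F 1 2 = comb F 1 0 0 ∧ loopGen F 2 1 = comb F (-1) 0 0 ∧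
    loopGen F 2 3 = comb F 0 1 0 ∧ loopGen F 3 2 = comb F 0 (-1) 0 ∧
    loopGen F 3 1 = comb F 0 0 1 ∧ loopGen F 1 3 = comb F 0 0 (-1) ∧
    loopGen F 0 3 = comb F 0 (t F) (t F - 1) ∧ loopGen F 3 0 = comb F 0 (-t F) (-(t F - 1)) ∧
    loopGen F 0 1 = comb F (t' F - 1) 0 (t' F) ∧ loopGen F 1 0 = comb F (-(t' F - 1)) 0 (-t' F) ∧
    loopGen F 0 2 = comb F (t'' F) (t'' F - 1) 0 ∧
    loopGen F 2 0 = comb F (-t'' F) (-(t'' F - 1)) 0 := by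
  refine ⟨?_, ?_, ?_, ?_, ?_, ?_, ?_, ?_, ?_, ?_, ?_, ?_⟩ <;>
  · simp only [loopGen, comb, TensorProduct.neg_tmul, TensorProduct.zero_tmul]
    abel

theorem loopGen_skew (i j : Fin 4) (hij : i ≠ j) : loopGen F i j + loopGen F j i = 0 := by
  fin_cases i <;> fin_cases j <;> first | exact absurd rfl hij | simp [loopGen]

theorem loopGen_norm (i j : Fin 4) (hij : i ≠ j) : ∃ a b c : LaurentA F,
    loopGen F i j = comb F a b c ∧
      a ^ 2 + b ^ 2 + c ^ 2 - 2 * a * b - 2 * b * c - 2 * c * a = 1 := by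
  obtain ⟨h1, h2, h3, h4, h5, h6, h7, h8, h9, h10, h11, h12⟩ := loopGen_values F
  fin_cases i <;> fin_cases j <;>
    first
    | exact absurd rfl hij
    | exact ⟨_, _, _, h1, by ring⟩
    | exact ⟨_, _, _, h2, by ring⟩
    | exact ⟨_, _, _, h3, by ring⟩
    | exact ⟨_, _, _, h4, by ring⟩
    | exact ⟨_, _, _, h5, by ring⟩
    | exact ⟨_, _, _, h6, by ring⟩
    | exact ⟨_, _, _, h7, by ring⟩
    | exact ⟨_, _, _, h8, by ring⟩
    | exact ⟨_, _, _, h9, by ring⟩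
    | exact ⟨_, _, _, h10, by ring⟩
    | exact ⟨_, _, _, h11, by ring⟩
    | exact ⟨_, _, _, h12, by ring⟩

set_option maxHeartbeats 4000000 in
theorem loopGen_triangle (i j k : Fin 4) (hij : i ≠ j) (hjk : j ≠ k) (hik : i ≠ k) :
    ⁅loopGen F i j, loopGen F j k⁆ = (2 : F) • loopGen F i j + (2 : F) • loopGen F j k := by
  obtain ⟨h1, h2, h3, h4, h5, h6, h7, h8, h9, h10, h11, h12⟩ := loopGen_values F
  obtain ⟨e1, e2⟩ := t_mul F
  have e3 : t' F = 1 - Ring.inverse (t F) := rfl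
  have e4 : t'' F = Ring.inverse (1 - t F) := rfl
  generalize Ring.inverse (t F) = s at *
  generalize Ring.inverse (1 - t F) = r at *
  rw [e3] at h9 h10
  rw [e4] at h11 h12
  generalize t F = u at *
  fin_cases i <;> fin_cases j <;> first | exact absurd rfl hij | fin_cases k <;>
    first
    | exact absurd rfl hik
    | exact absurd rfl hjk
    | (simp only [Fin.reduceFinMk, Fin.zero_eta, Fin.mk_one, Fin.isValue, h1, h2, h3, h4, h5, h6,
        h7, h8, h9, h10, h11, h12, comb_lie, comb_two, comb_add]
       congr 1 <;>
         first
         | ring1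
         | grind only)

/-- The homomorphism `σ` from the tetrahedron algebra to the loop algebra sending `x_{12}` to
`x ⊗ 1`, `x_{23}` to `y ⊗ 1`, `x_{31}` to `z ⊗ 1`, `x_{03}` to `y ⊗ t + z ⊗ (t - 1)`, `x_{01}` to
`z ⊗ t' + x ⊗ (t' - 1)` and `x_{02}` to `x ⊗ t'' + y ⊗ (t'' - 1)`. -/
def sigma : Tet F →ₗ⁅F⁆ Loop F :=
  descend F (FreeLieAlgebra.lift F fun p : Gen => loopGen F p.1.1 p.1.2) <| by
    intro r hr
    have key : ∀ (i j : Fin 4) (hij : i ≠ j),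
        FreeLieAlgebra.lift F (fun p : Gen => loopGen F p.1.1 p.1.2) (freeGen F i j hij)
          = loopGen F i j := fun i j hij => FreeLieAlgebra.lift_of_apply _ _
    cases hr with
    | skew i j hij => rw [map_add, key, key, loopGen_skew F i j hij]
    | triangle i j k hij hjk hik =>
      simp only [map_add, map_sub, map_smul, LieHom.map_lie, key]
      rw [loopGen_triangle F i j k hij hjk hik, sub_self]
    | dolanGrady h i j k hij hkh hhi hhj hki hkj =>
      simp only [map_sub, map_smul, LieHom.map_lie, key]
      obtain ⟨a, b, c, h1, hq⟩ := loopGen_norm F i j hij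
      obtain ⟨a', b', c', h2, -⟩ := loopGen_norm F k h hkh
      rw [h1, h2, comb_dolanGrady F a b c a' b' c' hq, sub_self]

theorem sigma_x (i j : Fin 4) (hij : i ≠ j) : sigma F (x F i j hij) = loopGen F i j :=
  FreeLieAlgebra.lift_of_apply _ _

/-- The three subspaces `X^σ_{kh} ∩ O`, `X^σ_{hi} ∩ O`, `X^σ_{ij} ∩ O` of the loop algebra, where
`X^σ_{ij}` is the image of `X_{ij}` under `σ`, and `O` stands for its own image. -/
def pathSummandsLoop (k h i j : Fin 4) (hkh : k ≠ h := by decide) (hhi : h ≠ i := by decide)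
    (hij : i ≠ j := by decide) : Fin 3 → Submodule F (Loop F) :=
  ![(X F k h hkh).map (sigma F : Tet F →ₗ[F] Loop F) ⊓ ((onsager F).map (sigma F)).toSubmodule,
    (X F h i hhi).map (sigma F : Tet F →ₗ[F] Loop F) ⊓ ((onsager F).map (sigma F)).toSubmodule,
    (X F i j hij).map (sigma F : Tet F →ₗ[F] Loop F) ⊓ ((onsager F).map (sigma F)).toSubmodule]

end Tetrahedron

end

/-! The map `sigma` is injective on O, and in its image everything can be read off from coordinates.

The generators x_{12}, x_{03} form a Dolan-Grady pair. Repeated reflection yields a sequence A_m (m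
∈ ℤ) with A_0 = x_{12}, A_1 = x_{03}; with G_l = [A_l, A_0] it satisfies [A_l, A_m] = G_{l-m}, [G_l,
A_m] = 2A_{m+l} - 2A_{m-l} and [G_l, G_m] = 0. The core is `IsOnsagerSeq.lie_step`. Hence the A_m
and G_l span O. In the loop algebra A_m becomes U_{m-1}(1-2t) A_1 - U_{m-2}(1-2t) A_0, with U the
Chebyshev polynomials of the second kind (`sigma_seqA`), and the independence of the U_n with n ≥ 0
gives injectivity on O (`eq_zero_of_sigma_eq_zero`).

A generator x_{ij} need not lie in O, but O + F x_{ij} is stable under ad x_{ij}, and `sigma` is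
still injective there. The cubic relations hold for all elements of the loop algebra in question, so
an element ξ of O is x_{ij}-like as soon as its image commutes with that of x_{ij} (`mem_X_iff`).

In the equitable basis the image of O is an F[t]-module of triples (p, tq, (t-1)r) with polynomial
p, q, r. The images of x_{03}, x_{31}, x_{12} are (0, t, t-1), (0, 0, 1), (1, 0, 0), and the
identity (p, tq, (t-1)r) = q(0, t, t-1) + (0, 0, (t-1)(r-q)) + p(1, 0, 0) is the decomposition
[0312]. The group G carries it to the other three, and injectivity on O carries all four to the loop
algebra. -/

noncomputable section

namespace Tetrahedron

/-! ### Dolan-Grady pairs and the Onsager relations -/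

section DolanGrady

variable (F : Type*) [Field F] {L : Type*} [LieRing L] [LieAlgebra F L]

/-- The Dolan-Grady relation `[p, [p, [p, q]]] = 4 [p, q]`. -/
def IsDolanGrady (p q : L) : Prop := ⁅p, ⁅p, ⁅p, q⁆⁆⁆ = (4 : F) • ⁅p, q⁆

/-- The element obtained from `p` by changing the sign of its eigencomponents for the
eigenvalues `±2` of `ad q`. -/
def reflect (q p : L) : L := p - (2 : F)⁻¹ • ⁅q, ⁅q, p⁆⁆

variable {F}

/-- Grade by the eigenvalues of ad q: u has weight 0, while H and K have weights ±2, and [K, H] has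
weight 0. In the expansion of the hypothesis, the part M of even degree in K has weights ±2 and the
part E of odd degree has weights 0, ±4. Since E + M = 0, both vanish, so the sign of K is
immaterial. -/
theorem IsDolanGrady.of_odd_part [CharZero F] {q u H K : L} (hu : ⁅q, u⁆ = 0)
    (hH : ⁅q, H⁆ = (2 : F) • K) (hK : ⁅q, K⁆ = (2 : F) • H)
    (h : ⁅u + K, ⁅u + K, H⁆⁆ = (4 : F) • H) :
    ⁅u - K, ⁅u - K, H⁆⁆ = (4 : F) • H := by
  have D : ∀ a b : L, ⁅q, ⁅a, b⁆⁆ = ⁅⁅q, a⁆, b⁆ + ⁅a, ⁅q, b⁆⁆ := leibniz_lie q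
  obtain ⟨E, hE⟩ : ∃ E, E = ⁅K, ⁅u, H⁆⁆ + ⁅u, ⁅K, H⁆⁆ := ⟨_, rfl⟩
  obtain ⟨M, hM⟩ : ∃ M, M = ⁅u, ⁅u, H⁆⁆ + ⁅K, ⁅K, H⁆⁆ - (4 : F) • H := ⟨_, rfl⟩
  have hsum : E = -M := by
    rw [hE, hM]
    simp only [lie_add, add_lie] at h
    linear_combination (norm := module) h
  have hE3 : ⁅q, ⁅q, ⁅q, E⁆⁆⁆ = (16 : F) • ⁅q, E⁆ := by
    rw [hE]
    simp only [D, hu, hH, hK, lie_add, lie_smul, smul_lie, lie_self, lie_zero, zero_lie, smul_zero,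
      add_zero, zero_add, smul_add, smul_smul]
    module
  have hM2 : ⁅q, ⁅q, M⁆⁆ = (4 : F) • M := by
    rw [hM]
    simp only [D, hu, hH, hK, lie_add, lie_sub, lie_smul, smul_lie, lie_self, lie_zero,
      zero_lie, smul_zero, add_zero, zero_add, smul_smul]
    module
  have hE2 : ⁅q, ⁅q, E⁆⁆ = (4 : F) • E := by rw [hsum, lie_neg, lie_neg, hM2, smul_neg]
  have hqE : ⁅q, E⁆ = 0 := by
    rw [hE2, lie_smul, ← sub_eq_zero, ← sub_smul] at hE3
    exact (smul_eq_zero.1 hE3).resolve_left (by norm_num)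
  have hE0 : E = 0 := by
    rw [hqE, lie_zero] at hE2
    exact (smul_eq_zero.1 hE2.symm).resolve_left (by norm_num)
  have hM0 : M = 0 := by rw [← neg_eq_zero, ← hsum, hE0]
  rw [hE0] at hE
  rw [hM0] at hM
  simp only [lie_sub, sub_lie]
  linear_combination (norm := module) hE - hM

variable [CharZero F]

theorem lie_reflect {p q : L} (h : IsDolanGrady F q p) : ⁅q, reflect F q p⁆ = -⁅q, p⁆ := by
  unfold IsDolanGrady at h
  rw [reflect, lie_sub, lie_smul, h]
  module

theorem reflect_reflect {p q : L} (h : IsDolanGrady F q p) :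
    reflect F q (reflect F q p) = p := by
  rw [reflect, lie_reflect h, reflect, lie_neg]
  module

theorem IsDolanGrady.reflect_right {p q : L} (h : IsDolanGrady F q p) :
    IsDolanGrady F q (reflect F q p) := by
  have h' := h
  unfold IsDolanGrady at h ⊢
  rw [lie_reflect h', lie_neg, lie_neg, h, smul_neg]

/-- Here p = u + K and `reflect F q p` = u - K, where u commutes with q and K collects the
components of p of weights ±2; the relation for p is carried over by `IsDolanGrady.of_odd_part`. It
makes `pairStep` a map of Dolan-Grady pairs. -/
theorem IsDolanGrady.reflect_left {p q : L} (hp : IsDolanGrady F p q) (hq : IsDolanGrady F q p) :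
    IsDolanGrady F (reflect F q p) q := by
  have hq' := hq
  unfold IsDolanGrady at hp hq
  obtain ⟨K, hKdef⟩ : ∃ K, K = (4 : F)⁻¹ • ⁅q, ⁅q, p⁆⁆ := ⟨_, rfl⟩
  obtain ⟨H, hHdef⟩ : ∃ H, H = (2 : F)⁻¹ • ⁅q, p⁆ := ⟨_, rfl⟩
  have hqK : ⁅q, K⁆ = (2 : F) • H := by
    rw [hKdef, lie_smul, hq, hHdef, smul_smul, smul_smul]; norm_num
  have hqH : ⁅q, H⁆ = (2 : F) • K := by
    rw [hHdef, lie_smul, hKdef, smul_smul]; norm_num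
  have hqp : ⁅p, q⁆ = (-2 : F) • H := by
    rw [hHdef, smul_smul, ← lie_skew]; norm_num
  have hu : ⁅q, p - K⁆ = 0 := by
    rw [lie_sub, hqK, hHdef, smul_smul]; norm_num
  have hmain : ⁅p, ⁅p, H⁆⁆ = (4 : F) • H := by
    have h2 := hp
    rw [hqp, lie_smul, lie_smul, smul_comm] at h2
    exact smul_right_injective L (by norm_num : (-2 : F) ≠ 0) h2
  have hkey := IsDolanGrady.of_odd_part hu hqH hqK (by rwa [sub_add_cancel])
  have hr : p - K - K = reflect F q p := by
    rw [reflect, hKdef]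
    module
  rw [hr] at hkey
  unfold IsDolanGrady
  have h3 : ⁅reflect F q p, q⁆ = (2 : F) • H := by
    rw [← lie_skew, lie_reflect hq', neg_neg, hHdef, smul_smul]; norm_num
  rw [h3, lie_smul, lie_smul, hkey, smul_comm]

variable (F L) in
/-- The pairs whose two members satisfy the Dolan-Grady relations. -/
abbrev DolanGradyPair : Type _ := {w : L × L // IsDolanGrady F w.1 w.2 ∧ IsDolanGrady F w.2 w.1}

variable (F L) in
/-- The permutation `(p, q) ↦ (q, reflect q p)` of the set of Dolan-Grady pairs. -/
def pairStep : Equiv.Perm (DolanGradyPair F L) where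
  toFun w := ⟨(w.1.2, reflect F w.1.2 w.1.1), w.2.2.reflect_right, w.2.1.reflect_left w.2.2⟩
  invFun w := ⟨(reflect F w.1.1 w.1.2, w.1.1), w.2.2.reflect_left w.2.1, w.2.1.reflect_right⟩
  left_inv w := Subtype.ext <| Prod.ext (reflect_reflect w.2.2) rfl
  right_inv w := Subtype.ext <| Prod.ext rfl (reflect_reflect w.2.1)

/-- The doubly infinite sequence attached to a Dolan-Grady pair. -/
def onsagerSeq (w : DolanGradyPair F L) (m : ℤ) : L := ((pairStep F L ^ m) w).1.1

theorem pairStep_zpow_snd (w : DolanGradyPair F L) (m : ℤ) :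
    ((pairStep F L ^ m) w).1.2 = onsagerSeq w (m + 1) := by
  rw [onsagerSeq, add_comm, zpow_one_add]
  rfl

theorem onsagerSeq_add_two (w : DolanGradyPair F L) (m : ℤ) :
    onsagerSeq w (m + 2) = reflect F (onsagerSeq w (m + 1)) (onsagerSeq w m) := by
  rw [← pairStep_zpow_snd w m, show m + 2 = (m + 1) + 1 by ring, ← pairStep_zpow_snd, add_comm m,
    zpow_one_add]
  rfl

theorem isDolanGrady_onsagerSeq (w : DolanGradyPair F L) (m : ℤ) :
    IsDolanGrady F (onsagerSeq w (m + 1)) (onsagerSeq w m) := by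
  rw [← pairStep_zpow_snd]
  exact ((pairStep F L ^ m) w).2.2

variable (F) in
/-- A sequence in which consecutive members have a constant bracket that shifts the sequence. -/
structure IsOnsagerSeq (A : ℤ → L) : Prop where
  lie_succ : ∀ m, ⁅A (m + 1), A m⁆ = ⁅A 1, A 0⁆
  lie_shift : ∀ m, ⁅⁅A 1, A 0⁆, A m⁆ = (2 : F) • A (m + 1) - (2 : F) • A (m - 1)

/-- Reflection in A_{m+1} negates the bracket with A_{m+1}, so consecutive brackets agree. The shift
rule is the definition of A_{m+1} as a reflection of A_{m-1}, solved for the double bracket. -/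
theorem isOnsagerSeq_onsagerSeq (w : DolanGradyPair F L) : IsOnsagerSeq F (onsagerSeq w) := by
  have hstep : ∀ m, ⁅onsagerSeq w (m + 2), onsagerSeq w (m + 1)⁆
      = ⁅onsagerSeq w (m + 1), onsagerSeq w m⁆ := fun m => by
    rw [onsagerSeq_add_two, ← lie_skew, lie_reflect (isDolanGrady_onsagerSeq w m), neg_neg]
  have hconst : ∀ m, ⁅onsagerSeq w (m + 1), onsagerSeq w m⁆ = ⁅onsagerSeq w 1, onsagerSeq w 0⁆ := by
    intro m
    induction m using Int.induction_on with
    | zero => rw [zero_add]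
    | succ i ih => rw [← ih, ← hstep i]; congr 2
    | pred i ih =>
      rw [← ih, ← hstep]
      congr 2 <;> ring
  refine ⟨hconst, fun m => ?_⟩
  rw [← hconst (m - 1)]
  have h2 := onsagerSeq_add_two w (m - 1)
  rw [show m - 1 + 2 = m + 1 by ring, sub_add_cancel, reflect] at h2
  rw [h2, sub_add_cancel, ← lie_skew, smul_sub, smul_smul]
  module

/-! ### The Onsager relations, derived from consecutive brackets -/

namespace IsOnsagerSeq

variable {A : ℤ → L}

/-- Induction on n, both claims together. For n = l + 2 the bracket g(m) = [A_{m+n}, A_m] is first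
shown to be affine in m with slope D/2, where D = [G_1, G_{l+1}]; expanding D in a second way forces
D = 0. -/
theorem lie_step (hA : IsOnsagerSeq F A) (n : ℕ) :
    (∀ m, ⁅A (m + n), A m⁆ = ⁅A n, A 0⁆) ∧
      ∀ m, ⁅⁅A n, A 0⁆, A m⁆ = (2 : F) • A (m + n) - (2 : F) • A (m - n) := by
  induction n using Nat.strong_induction_on with
  | _ n ih =>
  rcases n with _ | _ | l
  · simp
  · exact ⟨fun m => by simpa using hA.lie_succ m, fun m => by simpa using hA.lie_shift m⟩
  obtain ⟨ha, hb⟩ := ih (l + 1) (by omega)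
  obtain ⟨ha', hb'⟩ := ih l (by omega)
  obtain ⟨G, hG⟩ : ∃ G, G = ⁅A 1, A 0⁆ := ⟨_, rfl⟩
  obtain ⟨g, hg⟩ : ∃ g : ℤ → L, ∀ m, g m = ⁅A (m + (l + 2)), A m⁆ := ⟨_, fun _ => rfl⟩
  obtain ⟨D, hD⟩ : ∃ D, D = ⁅G, ⁅A (l + 1), A 0⁆⁆ := ⟨_, rfl⟩
  have hsh := hA.lie_shift
  rw [← hG] at hsh
  push_cast at ha hb ha' hb' ⊢
  -- Apply ad G_1 to G_{l+1} = [A_{m+l+1}, A_m]; the two terms in G_l cancel.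
  have hdiff : ∀ m, D = (2 : F) • g m - (2 : F) • g (m - 1) := by
    intro m
    have e1 : ⁅A (m + (l + 1) - 1), A m⁆ = ⁅A l, A 0⁆ := by
      rw [← ha' m]; congr 2; ring
    have e2 : ⁅A (m + (l + 1)), A (m + 1)⁆ = ⁅A l, A 0⁆ := by
      rw [← ha' (m + 1)]; congr 2; ring
    rw [hD, ← ha m, leibniz_lie, hsh, hsh, lie_sub, sub_lie, lie_smul, lie_smul, smul_lie, smul_lie,
      e1, e2, hg, hg, show m + (l + 1 : ℤ) + 1 = m + (l + 2) by ring,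
      show m - 1 + (l + 2 : ℤ) = m + (l + 1) by ring]
    module
  have hlin : ∀ k : ℕ, (2 : F) • g (-k) = (2 : F) • g 0 - (k : F) • D := by
    intro k
    induction k with
    | zero => simp
    | succ k ihk =>
      have := hdiff (-k)
      rw [show -((k + 1 : ℕ) : ℤ) = -k - 1 by push_cast; ring]
      push_cast
      linear_combination (norm := module) ihk + this
  -- Now apply ad G_{l+1} to G_1 = [A_1, A_0]; again the terms in G_l cancel.
  have hDneg : -D = (2 : F) • g 0 - (2 : F) • g (-((l + 1 : ℕ) : ℤ)) := by
    have e1 : ⁅A 1, A (0 + (l + 1))⁆ = -⁅A l, A 0⁆ := by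
      rw [← lie_skew, ← ha' 1]; congr 3; ring
    have e2 : ⁅A (1 - (l + 1)), A 0⁆ = -⁅A l, A 0⁆ := by
      rw [← lie_skew, ← ha' (1 - (l + 1))]; congr 3; ring
    rw [hD, lie_skew, hG, leibniz_lie, hb, hb, lie_sub, sub_lie, lie_smul, lie_smul, smul_lie,
      smul_lie, e1, e2, hg, hg, zero_add, show (1 : ℤ) + (l + 1) = l + 2 by ring,
      show -((l + 1 : ℕ) : ℤ) + (l + 2) = 1 by push_cast; ring,
      show -((l + 1 : ℕ) : ℤ) = 0 - (l + 1) by push_cast; ring]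
    module
  -- Comparison with `hlin` at k = l + 1 gives -D = (l + 1)D, and l + 2 is nonzero in characteristic
  -- zero.
  have hD0 : D = 0 := by
    rw [hlin, sub_sub_cancel] at hDneg
    have h1 : ((l + 2 : ℕ) : F) • D = 0 := by
      have h2 : ((l + 1 : ℕ) : F) • D + D = 0 := by rw [← hDneg, neg_add_cancel]
      push_cast at h2 ⊢
      linear_combination (norm := module) h2
    exact (smul_eq_zero.1 h1).resolve_left (Nat.cast_ne_zero.2 (by omega))
  have hstep : ∀ m, g m = g (m - 1) := fun m => by
    have := hdiff m
    rw [hD0, ← smul_sub] at this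
    exact sub_eq_zero.1 ((smul_eq_zero.1 this.symm).resolve_left two_ne_zero)
  have hconst : ∀ m, g m = g 0 := by
    intro m
    induction m using Int.induction_on with
    | zero => rfl
    | succ i ih => rw [hstep, add_sub_cancel_right, ih]
    | pred i ih => rw [← hstep, ih]
  have hfirst : ∀ m, ⁅A (m + (l + 2)), A m⁆ = ⁅A (l + 2), A 0⁆ := fun m => by
    rw [← hg, hconst, hg, zero_add]
  refine ⟨fun m => by simpa [add_assoc, one_add_one_eq_two] using hfirst m, fun m => ?_⟩
  -- By independence of m, G_{l+2} may be written as [A_{m+l+1}, A_{m-1}]; the Jacobi identity with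
  -- A_m then involves only G_1 and G_{l+1}.
  have e1 : ⁅A (m + (l + 1)), A (m - 1)⁆ = ⁅A (l + 2), A 0⁆ := by
    rw [← hfirst (m - 1)]; congr 2; ring
  have e2 : ⁅A (m - 1), A m⁆ = -G := by
    rw [← lie_skew, hG, ← hA.lie_succ (m - 1), sub_add_cancel]
  have e3 := ha m
  have hJ := lie_lie (A (m + (l + 1))) (A (m - 1)) (A m)
  rw [e1, e2, e3, lie_neg, ← lie_skew _ G, hsh, ← lie_skew (A (m - 1)), hb] at hJ
  rw [show (l : ℤ) + 1 + 1 = l + 2 by ring, hJ, show m + (l + 1 : ℤ) + 1 = m + (l + 2) by ring,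
    show m + (l + 1 : ℤ) - 1 = m - 1 + (l + 1) by ring,
    show m - 1 - (l + 1 : ℤ) = m - (l + 2) by ring]
  module

theorem lie_add (hA : IsOnsagerSeq F A) (l m : ℤ) : ⁅A (m + l), A m⁆ = ⁅A l, A 0⁆ := by
  obtain ⟨n, rfl | rfl⟩ := l.eq_nat_or_neg
  · exact (hA.lie_step n).1 m
  · have h1 := (hA.lie_step n).1 (m + -n)
    have h2 := (hA.lie_step n).1 (-n)
    rw [neg_add_cancel_right] at h1
    rw [neg_add_cancel] at h2
    rw [← lie_skew, h1, ← h2, lie_skew]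

theorem lie_lie_eq (hA : IsOnsagerSeq F A) (l m : ℤ) :
    ⁅⁅A l, A 0⁆, A m⁆ = (2 : F) • A (m + l) - (2 : F) • A (m - l) := by
  obtain ⟨n, rfl | rfl⟩ := l.eq_nat_or_neg
  · exact (hA.lie_step n).2 m
  · have h2 := (hA.lie_step n).1 (-n)
    rw [neg_add_cancel] at h2
    have h3 : ⁅A (-n), A 0⁆ = -⁅A n, A 0⁆ := by rw [← h2, lie_skew]
    rw [h3, neg_lie, (hA.lie_step n).2, sub_neg_eq_add, ← sub_eq_add_neg]
    module

theorem lie_neg_eq (hA : IsOnsagerSeq F A) (l : ℤ) : ⁅A (-l), A 0⁆ = -⁅A l, A 0⁆ := by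
  have h := hA.lie_add l (-l)
  rw [neg_add_cancel] at h
  rw [← h, lie_skew]

theorem lie_eq (hA : IsOnsagerSeq F A) (l m : ℤ) : ⁅A l, A m⁆ = ⁅A (l - m), A 0⁆ := by
  rw [← hA.lie_add, add_sub_cancel]

/-- By the Leibniz rule the bracket is a combination of G_{m+l} and G_{m-l} in which everything
cancels. -/
theorem lie_lie_lie_eq_zero (hA : IsOnsagerSeq F A) (l m : ℤ) :
    ⁅⁅A l, A 0⁆, ⁅A m, A 0⁆⁆ = 0 := by
  rw [leibniz_lie, hA.lie_lie_eq, hA.lie_lie_eq, lie_sub, sub_lie, lie_smul, lie_smul, smul_lie,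
    smul_lie, hA.lie_eq m, hA.lie_eq m, zero_add, zero_sub, sub_neg_eq_add]
  module

theorem lieSpan_le_span (hA : IsOnsagerSeq F A) :
    (LieSubalgebra.lieSpan F L {A 0, A 1}).toSubmodule ≤
      Submodule.span F (Set.range A ∪ Set.range fun l => ⁅A l, A 0⁆) := by
  obtain ⟨S, hS⟩ : ∃ S, S = Submodule.span F (Set.range A ∪ Set.range fun l => ⁅A l, A 0⁆) :=
    ⟨_, rfl⟩
  have hAm : ∀ m, A m ∈ S := fun m => hS ▸ Submodule.subset_span (.inl ⟨m, rfl⟩)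
  have hGm : ∀ m, ⁅A m, A 0⁆ ∈ S := fun m => hS ▸ Submodule.subset_span (.inr ⟨m, rfl⟩)
  have hmul : ∀ a ∈ S, ∀ b ∈ S, ⁅a, b⁆ ∈ S := by
    intro a ha b hb
    rw [hS] at ha hb
    induction ha, hb using Submodule.span_induction₂ with
    | mem_mem a b ha hb =>
      have hGA : ∀ l m, ⁅⁅A l, A 0⁆, A m⁆ ∈ S := fun l m => by
        rw [hA.lie_lie_eq]
        exact S.sub_mem (S.smul_mem _ (hAm _)) (S.smul_mem _ (hAm _))
      rcases ha with ⟨l, rfl⟩ | ⟨l, rfl⟩ <;> rcases hb with ⟨m, rfl⟩ | ⟨m, rfl⟩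
      · rw [hA.lie_eq]; exact hGm _
      · rw [← lie_skew]; exact S.neg_mem (hGA _ _)
      · exact hGA _ _
      · simp only [hA.lie_lie_lie_eq_zero, S.zero_mem]
    | zero_left b hb => rw [zero_lie]; exact S.zero_mem
    | zero_right a ha => rw [lie_zero]; exact S.zero_mem
    | add_left a a' b _ _ _ h h' => rw [add_lie]; exact S.add_mem h h'
    | add_right a b b' _ _ _ h h' => rw [_root_.lie_add]; exact S.add_mem h h'
    | smul_left r a b _ _ h => rw [smul_lie]; exact S.smul_mem r h
    | smul_right r a b _ _ h => rw [lie_smul]; exact S.smul_mem r h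
  rw [← hS]
  exact LieSubalgebra.lieSpan_le (K := { S with lie_mem' := fun {a b} ha hb => hmul a ha b hb }).2
    (by rintro _ (rfl | rfl) <;> exact hAm _)

end IsOnsagerSeq

end DolanGrady

end Tetrahedron

namespace Tetrahedron

/-! ### Coordinates in the loop algebra -/

section Loop

variable (F : Type*) [Field F]

/-- The matrix entry functionals on `sl₂`. -/
def slEntry (i j : Fin 2) : Sl2 F →ₗ[F] F where
  toFun u := slVal F u i j
  map_add' _ _ := rfl
  map_smul' _ _ := rfl

/-- The matrix entry maps on the loop algebra. -/
def loopEntry (i j : Fin 2) : Loop F →ₗ[F] LaurentA F :=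
  (TensorProduct.rid F (LaurentA F)).toLinearMap ∘ₗ (slEntry F i j).lTensor (LaurentA F)

theorem loopEntry_tmul (i j : Fin 2) (a : LaurentA F) (u : Sl2 F) :
    loopEntry F i j (a ⊗ₜ u) = slVal F u i j • a := by
  simp only [loopEntry, LinearMap.comp_apply, LinearMap.lTensor_tmul, LinearEquiv.coe_coe,
    TensorProduct.rid_tmul]
  rfl

theorem loopEntry_comb (a b c : LaurentA F) :
    loopEntry F 0 1 (comb F a b c) = 2 * a ∧ loopEntry F 1 0 (comb F a b c) = -(2 * b) ∧
      loopEntry F 0 0 (comb F a b c) = c - a - b := by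
  refine ⟨?_, ?_, ?_⟩ <;>
  · simp [comb, loopEntry_tmul, eqX, eqY, eqZ, slE, slF, slH, slVal_add, slVal_sub, slVal_neg,
      slVal_mk, two_smul, add_smul, two_mul]
    try ring

theorem smul_comb (r a b c : LaurentA F) :
    r • comb F a b c = comb F (r * a) (r * b) (r * c) := by
  simp only [comb, smul_add, TensorProduct.smul_tmul', smul_eq_mul]

theorem smul_comb' (r : F) (a b c : LaurentA F) :
    r • comb F a b c = comb F (r • a) (r • b) (r • c) := by
  simp only [comb, smul_add, TensorProduct.smul_tmul']

theorem comb_sub (a b c a' b' c' : LaurentA F) :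
    comb F a b c - comb F a' b' c' = comb F (a - a') (b - b') (c - c') := by
  rw [sub_eq_add_neg, comb_neg, comb_add]
  simp only [sub_eq_add_neg]

theorem comb_zero : comb F 0 0 0 = 0 := by simp [comb]

theorem algebraMap_injective : Function.Injective (algebraMap F[X] (LaurentA F)) := by
  refine IsLocalization.injective (M := Submonoid.powers (Polynomial.X * (Polynomial.X - 1) : F[X]))
    _ (powers_le_nonZeroDivisors_of_noZeroDivisors (mul_ne_zero Polynomial.X_ne_zero ?_))
  exact Polynomial.X_sub_C_ne_zero (1 : F)

variable {F} in
theorem eq_zero_of_periodic {α : ℤ →₀ F} (h : ∀ n, α (2 + n) = α n) : α = 0 := by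
  ext k
  by_contra hk
  have hper : ∀ j : ℕ, α (k + 2 * j) = α k := by
    intro j
    induction j with
    | zero => simp
    | succ j ih => rw [← ih, ← h (k + 2 * j)]; congr 1; push_cast; ring
  refine Set.infinite_of_injective_forall_mem (f := fun j : ℕ => k + 2 * (j : ℤ))
    (fun a b hab => by simpa using hab) (fun j => ?_) α.support.finite_toSet
  simpa [hper] using hk

/-- The substitution of `1 - 2t` in polynomials. -/
def evalC : F[X] →ₐ[F] LaurentA F :=
  (IsScalarTower.toAlgHom F F[X] (LaurentA F)).comp
    (Polynomial.aeval (1 - 2 * Polynomial.X : F[X]))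

theorem evalC_X : evalC F Polynomial.X = 1 - 2 * t F := by
  have h2 : algebraMap F[X] (LaurentA F) 2 = 2 := map_ofNat _ 2
  simp [evalC, t, h2]

/-! ### Uniqueness of coordinates and independence of Chebyshev polynomials -/

variable [CharZero F]

theorem isUnit_two : IsUnit (2 : LaurentA F) := by
  have := (isUnit_iff_ne_zero.2 (two_ne_zero : (2 : F) ≠ 0)).map (algebraMap F (LaurentA F))
  rwa [map_ofNat] at this

theorem comb_inj {a b c a' b' c' : LaurentA F} :
    comb F a b c = comb F a' b' c' ↔ a = a' ∧ b = b' ∧ c = c' := by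
  refine ⟨fun h => ?_, by rintro ⟨rfl, rfl, rfl⟩; rfl⟩
  obtain ⟨h1, h2, h3⟩ := loopEntry_comb F a b c
  obtain ⟨h1', h2', h3'⟩ := loopEntry_comb F a' b' c'
  have ha : a = a' := (isUnit_two F).mul_left_cancel (by rw [← h1, ← h1', h])
  have hb : b = b' := (isUnit_two F).mul_left_cancel (neg_injective (by rw [← h2, ← h2', h]))
  refine ⟨ha, hb, ?_⟩
  have hc : c - a - b = c' - a' - b' := by rw [← h3, ← h3', h]
  rw [ha, hb] at hc
  simpa using hc

theorem comb_eq_zero {a b c : LaurentA F} : comb F a b c = 0 ↔ a = 0 ∧ b = 0 ∧ c = 0 := by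
  rw [← comb_zero F, comb_inj]

variable {F}

open Polynomial.Chebyshev in
/-- A finite combination of shifted Chebyshev polynomials of the second kind vanishes only if its
coefficients are symmetric. -/
theorem apply_eq_of_sum_chebyshev_eq_zero (c : ℤ) {α : ℤ →₀ F}
    (h : Finsupp.linearCombination F (fun m => U F (m - c)) α = 0) (n : ℤ) :
    α (c + n) = α (c - 2 - n) := by
  have key : ∀ n : ℕ, α (c + n) = α (c - 2 - n) := by
    intro n
    -- U_n has degree n for n ≥ 0, so these polynomials form a basis. Since U_{-n-2} = -U_n and
    -- U_{-1} = 0, the n-th coordinate of the combination is α(c+n) - α(c-2-n).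
    let S : Polynomial.Sequence F := ⟨fun n => U F n, fun n => degree_U_natCast F n⟩
    have hS : ∀ i, IsUnit (S i).leadingCoeff := fun i =>
      (Polynomial.leadingCoeff_ne_zero.2 (S.ne_zero i)).isUnit
    have hcoord : ∀ k : ℕ, (S.basis hS).coord n (U F k) = if k = n then 1 else 0 := by
      intro k
      rw [show U F k = S.basis hS k from (S.basis_eq_self hS k).symm, Module.Basis.coord_apply,
        Module.Basis.repr_self, Finsupp.single_apply]
    have hmap : (S.basis hS).coord n ∘ₗ Finsupp.linearCombination F (fun m => U F (m - c)) =
        Finsupp.lapply (c + n) - Finsupp.lapply (c - 2 - n) := by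
      refine Finsupp.lhom_ext' fun m => LinearMap.ext_ring ?_
      simp only [LinearMap.comp_apply, Finsupp.lsingle_apply, Finsupp.linearCombination_single,
        one_smul, LinearMap.sub_apply, Finsupp.lapply_apply, Finsupp.single_apply]
      obtain ⟨k, hk⟩ | ⟨k, hk⟩ | hk : (∃ k : ℕ, m - c = k) ∨ (∃ k : ℕ, m - c = -k - 2) ∨
          m - c = -1 := by
        rcases lt_trichotomy (m - c) (-1) with h | h | h
        · exact .inr (.inl ⟨(-(m - c) - 2).toNat, by omega⟩)
        · exact .inr (.inr h)
        · exact .inl ⟨(m - c).toNat, by omega⟩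
      · rw [hk, hcoord, if_neg (show m ≠ c - 2 - n by omega), sub_zero]
        exact if_congr (by omega) rfl rfl
      · rw [hk, U_neg_sub_two, map_neg, hcoord, if_neg (show m ≠ c + n by omega), zero_sub]
        exact congrArg _ (if_congr (by omega) rfl rfl)
      · rw [hk, U_neg_one, map_zero, if_neg (show m ≠ c + n by omega),
          if_neg (show m ≠ c - 2 - n by omega), sub_zero]
    have := LinearMap.congr_fun hmap α
    rw [LinearMap.comp_apply, h, map_zero] at this
    exact sub_eq_zero.1 this.symm
  -- The claim is invariant under n ↦ -2 - n, whose fixed point is -1; this reduces it to n ≥ 0.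
  rcases lt_trichotomy n (-1) with h | rfl | h
  · have := key (-n - 2).toNat
    rw [Int.toNat_of_nonneg (by omega)] at this
    convert this.symm using 2 <;> ring
  · congr 1
    ring
  · have := key n.toNat
    rwa [Int.toNat_of_nonneg (by omega)] at this

variable (F)

theorem evalC_injective : Function.Injective (evalC F) := by
  rw [injective_iff_map_eq_zero]
  intro p hp
  have h : p.comp (1 - 2 * Polynomial.X) = 0 := by
    refine (injective_iff_map_eq_zero _).1 (algebraMap_injective F) _ ?_
    rwa [Polynomial.comp_eq_aeval]
  have hdeg : (1 - 2 * Polynomial.X : F[X]) ≠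
      Polynomial.C ((1 - 2 * Polynomial.X : F[X]).coeff 0) := by
    intro h
    have := congrArg (fun q => Polynomial.coeff q 1) h
    simp [Polynomial.coeff_one] at this
  exact (Polynomial.comp_eq_zero_iff.1 h).resolve_right fun h => hdeg h.2

end Loop

end Tetrahedron

namespace Tetrahedron

section Relations

variable (F : Type*) [Field F]

/-! ### Relations among the generators -/

theorem x_swap (i j : Fin 4) (hij : i ≠ j) : x F j i hij.symm = -x F i j hij := by
  have h := toTet_eq_zero F (.skew i j hij)
  rw [map_add] at h
  exact eq_neg_of_add_eq_zero_right h

theorem lie_x (i j k : Fin 4) (hij : i ≠ j) (hjk : j ≠ k) (hik : i ≠ k) :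
    ⁅x F i j hij, x F j k hjk⁆ = (2 : F) • x F i j hij + (2 : F) • x F j k hjk := by
  have h := toTet_eq_zero F (.triangle i j k hij hjk hik)
  rw [map_sub, map_add, map_smul, map_smul, LieHom.map_lie] at h
  exact sub_eq_zero.1 h

theorem isDolanGrady_x (h i j k : Fin 4) (hij : i ≠ j) (hkh : k ≠ h)
    (hhi : h ≠ i) (hhj : h ≠ j) (hki : k ≠ i) (hkj : k ≠ j) :
    IsDolanGrady F (x F i j hij) (x F k h hkh) := by
  have h := toTet_eq_zero F (.dolanGrady h i j k hij hkh hhi hhj hki hkj)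
  simp only [map_sub, map_smul, LieHom.map_lie] at h
  exact sub_eq_zero.1 h

/-- The bracket of two generators with a common index lies in their span. -/
theorem exists_lie_x_eq (p q i j : Fin 4) (hpq : p ≠ q) (hij : i ≠ j)
    (h : p = i ∨ p = j ∨ q = i ∨ q = j) :
    ∃ c d : F, ⁅x F p q hpq, x F i j hij⁆ = c • x F p q hpq + d • x F i j hij := by
  by_cases h1 : p = i ∧ q = j
  · obtain ⟨rfl, rfl⟩ := h1
    exact ⟨0, 0, by simp⟩
  by_cases h2 : p = j ∧ q = i
  · obtain ⟨rfl, rfl⟩ := h2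
    exact ⟨0, 0, by rw [x_swap F p q hpq]; simp⟩
  rcases h with rfl | rfl | rfl | rfl
  · have hqj : q ≠ j := fun h => h1 ⟨rfl, h⟩
    refine ⟨2, -2, ?_⟩
    rw [x_swap F q p hpq.symm, neg_lie, lie_x F q p j _ _ hqj]
    module
  · have hqi : q ≠ i := fun h => h2 ⟨rfl, h⟩
    refine ⟨-2, -2, ?_⟩
    rw [← lie_skew, lie_x F i p q _ _ hqi.symm]
    module
  · have hpj : p ≠ j := fun h => h2 ⟨h, rfl⟩
    exact ⟨2, 2, lie_x F p q j _ _ hpj⟩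
  · have hpi : p ≠ i := fun h => h1 ⟨h, rfl⟩
    refine ⟨-2, 2, ?_⟩
    rw [x_swap F q i hij.symm, lie_neg, lie_x F p q i _ _ hpi]
    module

/-! ### The Onsager subalgebra is spanned by an Onsager sequence -/

theorem x_mem_onsager : x F 1 2 ∈ onsager F ∧ x F 0 3 ∈ onsager F :=
  ⟨LieSubalgebra.subset_lieSpan (.inl rfl), LieSubalgebra.subset_lieSpan (.inr rfl)⟩

open Polynomial.Chebyshev (U U_add_one U_sub_two)

theorem evalC_U_add_one (n : ℤ) :
    evalC F (U F (n + 1)) = 2 * (1 - 2 * t F) * evalC F (U F n) - evalC F (U F (n - 1)) := by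
  have h2 : evalC F 2 = 2 := map_ofNat _ 2
  rw [U_add_one, map_sub, map_mul, map_mul, evalC_X, h2]

theorem evalC_U_sub_two (n : ℤ) :
    evalC F (U F (n - 2)) = 2 * (1 - 2 * t F) * evalC F (U F (n - 1)) - evalC F (U F n) := by
  have h2 : evalC F 2 = 2 := map_ofNat _ 2
  rw [U_sub_two, map_sub, map_mul, map_mul, evalC_X, h2]

variable [CharZero F]

/-- The Onsager sequence starting with `x_{12}`, `x_{03}`. -/
def seqA : ℤ → Tet F :=
  onsagerSeq (F := F) ⟨(x F 1 2, x F 0 3), isDolanGrady_x F 3 1 2 0 _ _ (by decide) (by decide)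
    (by decide) (by decide), isDolanGrady_x F 2 0 3 1 _ _ (by decide) (by decide)
    (by decide) (by decide)⟩

theorem seqA_zero : seqA F 0 = x F 1 2 := rfl

theorem seqA_one : seqA F 1 = x F 0 3 := rfl

theorem isOnsagerSeq_seqA : IsOnsagerSeq F (seqA F) := isOnsagerSeq_onsagerSeq _

theorem onsager_le_span : (onsager F).toSubmodule ≤
    Submodule.span F (Set.range (seqA F) ∪ Set.range fun l => ⁅seqA F l, seqA F 0⁆) :=
  (isOnsagerSeq_seqA F).lieSpan_le_span

theorem exists_finsupp_of_mem_onsager {ξ : Tet F} (h : ξ ∈ onsager F) : ∃ α β : ℤ →₀ F,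
    ξ = Finsupp.linearCombination F (seqA F) α +
      Finsupp.linearCombination F (fun l => ⁅seqA F l, seqA F 0⁆) β := by
  have h := onsager_le_span F h
  rw [Submodule.span_union, Submodule.mem_sup] at h
  obtain ⟨a, ha, b, hb, rfl⟩ := h
  obtain ⟨α, rfl⟩ := (Finsupp.mem_span_range_iff_exists_finsupp).1 ha
  obtain ⟨β, rfl⟩ := (Finsupp.mem_span_range_iff_exists_finsupp).1 hb
  exact ⟨α, β, rfl⟩

/-! ### The restriction of `σ` to the Onsager subalgebra -/

theorem sigma_seqA_zero : sigma F (seqA F 0) = comb F 1 0 0 := by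
  rw [seqA_zero, sigma_x, (loopGen_values F).1]

theorem sigma_seqA_one : sigma F (seqA F 1) = comb F 0 (t F) (t F - 1) := by
  rw [seqA_one, sigma_x, (loopGen_values F).2.2.2.2.2.2.1]

theorem sigma_lie_seqA : sigma F ⁅seqA F 1, seqA F 0⁆ =
    comb F (-2) (-2 * t F) (2 * (t F - 1)) := by
  rw [LieHom.map_lie, sigma_seqA_zero, sigma_seqA_one, comb_lie]
  congr 1 <;> ring

/-- Both sides obey the recurrence given by the bracket with G_1 and agree at m = 0, 1. The argument
1 - 2t is the value on the images of x_{12} and x_{03} of the polarization of the quadratic form in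
`comb_dolanGrady`. -/
theorem sigma_seqA (m : ℤ) : sigma F (seqA F m) =
    evalC F (U F (m - 1)) • sigma F (seqA F 1) - evalC F (U F (m - 2)) • sigma F (seqA F 0) := by
  obtain ⟨B, hB⟩ : ∃ B : ℤ → Loop F, ∀ m, B m = evalC F (U F (m - 1)) • sigma F (seqA F 1) -
    evalC F (U F (m - 2)) • sigma F (seqA F 0) := ⟨_, fun _ => rfl⟩
  have hrec : ∀ m, ⁅sigma F ⁅seqA F 1, seqA F 0⁆, B m⁆
      = (2 : F) • B (m + 1) - (2 : F) • B (m - 1) := by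
    intro m
    have e1 := evalC_U_add_one F (m - 1)
    have e2 := evalC_U_sub_two F (m - 1)
    rw [sub_add_cancel, sub_sub, one_add_one_eq_two] at e1
    rw [sub_sub, sub_sub, one_add_one_eq_two] at e2
    simp only [hB, sigma_lie_seqA, sigma_seqA_one, sigma_seqA_zero, smul_comb, comb_sub, comb_lie,
      comb_two]
    rw [show m + 1 - 1 = m by ring, show m + 1 - 2 = m - 1 by ring,
      show m - 1 - 1 = m - 2 by ring, show m - 1 - 2 = m - (1 + 2) by ring, e1, e2]
    congr 1 <;> ring
  have hrec' : ∀ m, ⁅sigma F ⁅seqA F 1, seqA F 0⁆, sigma F (seqA F m)⁆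
      = (2 : F) • sigma F (seqA F (m + 1)) - (2 : F) • sigma F (seqA F (m - 1)) := by
    intro m
    rw [← LieHom.map_lie, (isOnsagerSeq_seqA F).lie_shift, map_sub, map_smul, map_smul]
  rw [← hB]
  suffices h : sigma F (seqA F m) = B m ∧ sigma F (seqA F (m + 1)) = B (m + 1) from h.1
  have inj := smul_right_injective (Loop F) (two_ne_zero : (2 : F) ≠ 0)
  induction m using Int.induction_on with
  | zero => constructor <;> simp [hB]
  | succ i ih =>
    refine ⟨ih.2, inj ?_⟩
    have h1 := hrec (i + 1)
    have h2 := hrec' (i + 1)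
    rw [ih.2, h1, add_sub_cancel_right, ih.1] at h2
    exact (sub_left_injective h2).symm
  | pred i ih =>
    rw [sub_add_cancel]
    refine ⟨inj ?_, ih.1⟩
    have h1 := hrec (-i)
    have h2 := hrec' (-i)
    rw [ih.1, h1, ih.2] at h2
    exact (sub_right_injective h2).symm

theorem sigma_lie_seqA_zero (l : ℤ) : sigma F ⁅seqA F l, seqA F 0⁆ =
    evalC F (U F (l - 1)) • sigma F ⁅seqA F 1, seqA F 0⁆ := by
  rw [LieHom.map_lie, LieHom.map_lie, sigma_seqA, sub_lie, smul_lie, smul_lie, lie_self, smul_zero,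
    sub_zero]

theorem sigma_finsupp (α β : ℤ →₀ F) :
    sigma F (Finsupp.linearCombination F (seqA F) α +
        Finsupp.linearCombination F (fun l => ⁅seqA F l, seqA F 0⁆) β) =
      evalC F (Finsupp.linearCombination F (fun m => U F (m - 1)) α) • sigma F (seqA F 1) -
        evalC F (Finsupp.linearCombination F (fun m => U F (m - 2)) α) • sigma F (seqA F 0) +
        evalC F (Finsupp.linearCombination F (fun m => U F (m - 1)) β) •
          sigma F ⁅seqA F 1, seqA F 0⁆ := by
  have hA := sigma_seqA F
  have hG := sigma_lie_seqA_zero F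
  generalize sigma F (seqA F 0) = a₀ at hA ⊢
  generalize sigma F (seqA F 1) = a₁ at hA ⊢
  generalize sigma F ⁅seqA F 1, seqA F 0⁆ = g at hG ⊢
  simp only [Finsupp.linearCombination_apply, Finsupp.sum, map_add, map_sum, map_smul, hA, hG,
    Finset.sum_smul, smul_sub, Finset.sum_sub_distrib, smul_assoc]

/-- The images of A_0, A_1, G_1 are independent over the loop coordinates, so three Chebyshev sums
P, Q, R vanish, and their coefficients acquire reflection symmetries. -/
theorem eq_zero_of_sigma_eq_zero {ξ : Tet F} (h : ξ ∈ onsager F) (h0 : sigma F ξ = 0) : ξ = 0 := by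
  obtain ⟨α, β, rfl⟩ := exists_finsupp_of_mem_onsager F h
  rw [sigma_finsupp, sigma_lie_seqA, sigma_seqA_one, sigma_seqA_zero] at h0
  simp only [smul_comb, comb_sub, comb_add, comb_eq_zero] at h0
  obtain ⟨h1, h2, h3⟩ := h0
  obtain ⟨P, hP⟩ : ∃ P, P = Finsupp.linearCombination F (fun m => U F (m - 1)) α := ⟨_, rfl⟩
  obtain ⟨Q, hQ⟩ : ∃ Q, Q = Finsupp.linearCombination F (fun m => U F (m - 2)) α := ⟨_, rfl⟩
  obtain ⟨R, hR⟩ : ∃ R, R = Finsupp.linearCombination F (fun m => U F (m - 1)) β := ⟨_, rfl⟩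
  simp only [← hP, ← hQ, ← hR] at h1 h2 h3
  have hut := (isUnit_t F).1
  have hut' := (isUnit_t F).2
  have h2' : t F * (evalC F P - 2 * evalC F R) = 0 := by linear_combination h2
  have h3' : (1 - t F) * (evalC F P + 2 * evalC F R) = 0 := by linear_combination -h3
  have h4 := hut.mul_right_eq_zero.1 h2'
  have h5 := hut'.mul_right_eq_zero.1 h3'
  have hR0 : evalC F R = 0 := (isUnit_two F).mul_right_eq_zero.1 <|
    (isUnit_two F).mul_right_eq_zero.1 (by linear_combination h5 - h4)
  have hP0 : evalC F P = 0 := by linear_combination h4 + 2 * hR0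
  have hQ0 : evalC F Q = 0 := by linear_combination -h1 - 2 * hR0
  have hinj := (injective_iff_map_eq_zero _).1 (evalC_injective F)
  have hα1 := apply_eq_of_sum_chebyshev_eq_zero 1 (hP.symm.trans (hinj _ hP0))
  have hα2 := apply_eq_of_sum_chebyshev_eq_zero 2 (hQ.symm.trans (hinj _ hQ0))
  have hβ1 := apply_eq_of_sum_chebyshev_eq_zero 1 (hR.symm.trans (hinj _ hR0))
  -- α is symmetric about 0 and about 1, hence invariant under translation by 2, which finite
  -- support excludes unless α = 0.
  have hα : α = 0 := eq_zero_of_periodic fun n => by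
    have h6 := hα1 (n - 1)
    rw [hα2, show (2 : ℤ) - 2 - n = 1 - 2 - (n - 1) by ring, ← h6, add_sub_cancel]
  have hβ : ∀ n, β (-n) = β n := fun n => by
    have h6 := hβ1 (n - 1)
    rw [add_sub_cancel] at h6
    rw [h6]
    congr 1
    ring
  -- β is even while G_{-l} = -G_l, so the sum equals its own negative; β itself need not vanish.
  have hsum : Finsupp.linearCombination F (fun l => ⁅seqA F l, seqA F 0⁆) β =
      -Finsupp.linearCombination F (fun l => ⁅seqA F l, seqA F 0⁆) β := by
    have hβ' : Finsupp.equivMapDomain (Equiv.neg ℤ) β = β := by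
      ext n
      simpa using hβ n
    conv_lhs => rw [← hβ']
    rw [Finsupp.linearCombination_equivMapDomain]
    simp only [Finsupp.linearCombination_apply, Finsupp.sum, Function.comp_def, Equiv.neg_apply,
      (isOnsagerSeq_seqA F).lie_neg_eq, smul_neg, Finset.sum_neg_distrib]
  rw [hα, map_zero, zero_add]
  have h2 : (2 : F) • Finsupp.linearCombination F (fun l => ⁅seqA F l, seqA F 0⁆) β = 0 := by
    rw [two_smul]
    nth_rw 1 [hsum]
    exact neg_add_cancel _
  exact (smul_eq_zero.1 h2).resolve_left two_ne_zero

end Relations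

end Tetrahedron

namespace Tetrahedron

section Image

variable (F : Type*) [Field F]

/-! ### The image of the Onsager subalgebra -/

/-- In `comb_lie`, every term of the second coordinate contains b or b', and every term of the third
contains c or c'; divisibility by t and t - 1 thus survives brackets. -/
theorem exists_sigma_eq_comb {ξ : Tet F} (h : ξ ∈ onsager F) : ∃ p q r : F[X],
    sigma F ξ = comb F (algebraMap _ _ p) (t F * algebraMap _ _ q)
      ((t F - 1) * algebraMap _ _ r) := by
  have htX : algebraMap F[X] (LaurentA F) Polynomial.X = t F := rfl
  have h2 : algebraMap F[X] (LaurentA F) 2 = 2 := map_ofNat _ 2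
  induction h using LieSubalgebra.lieSpan_induction with
  | mem ξ hξ =>
    obtain ⟨h1, -, -, -, -, -, h7, -⟩ := loopGen_values F
    obtain rfl | rfl := hξ
    · exact ⟨1, 0, 0, by rw [sigma_x, h1]; simp⟩
    · exact ⟨0, 1, 1, by rw [sigma_x, h7]; simp⟩
  | zero => exact ⟨0, 0, 0, by simp [comb_zero]⟩
  | add a b _ _ ha hb =>
    obtain ⟨p, q, r, hp⟩ := ha
    obtain ⟨p', q', r', hp'⟩ := hb
    refine ⟨p + p', q + q', r + r', ?_⟩
    rw [map_add, hp, hp', comb_add]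
    simp only [map_add, mul_add]
  | smul c a _ ha =>
    obtain ⟨p, q, r, hp⟩ := ha
    refine ⟨c • p, c • q, c • r, ?_⟩
    rw [map_smul, hp, smul_comb']
    simp only [algebraMap.coe_smul, Algebra.mul_smul_comm]
  | lie a b _ _ ha hb =>
    obtain ⟨p, q, r, hp⟩ := ha
    obtain ⟨p', q', r', hp'⟩ := hb
    refine ⟨2 * (p * (.X * q') - .X * q * p') + 2 * ((.X - 1) * r * p' - p * ((.X - 1) * r')),
      2 * (p * q' - q * p') + 2 * (q * ((.X - 1) * r') - (.X - 1) * r * q'),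
      2 * (.X * q * r' - r * (.X * q')) + 2 * (r * p' - p * r'), ?_⟩
    rw [LieHom.map_lie, hp, hp', comb_lie]
    simp only [map_add, map_sub, map_mul, map_one, h2, htX]
    congr 1 <;> ring

/-- Neither t nor t - 1 divides ±1 in F[t]: evaluate at 0, respectively 1. -/
theorem t_mul_ne_one (p : F[X]) : t F * algebraMap _ _ p ≠ 1 ∧ t F * algebraMap _ _ p ≠ -1 ∧
    (t F - 1) * algebraMap _ _ p ≠ 1 ∧ (t F - 1) * algebraMap _ _ p ≠ -1 := by
  have h : ∀ (u v : F[X]) (c : F), u.eval c = 0 → v.eval c ≠ 0 →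
      algebraMap F[X] (LaurentA F) u * algebraMap _ _ p ≠ algebraMap _ _ v := by
    intro u v c hu hv h
    rw [← map_mul] at h
    rw [← algebraMap_injective F h, Polynomial.eval_mul, hu, zero_mul] at hv
    exact hv rfl
  refine ⟨?_, ?_, ?_, ?_⟩
  · simpa [t] using h .X 1 0 (by simp) (by simp)
  · simpa [t] using h .X (-1) 0 (by simp) (by simp)
  · simpa [t] using h (.X - 1) 1 1 (by simp) (by simp)
  · simpa [t] using h (.X - 1) (-1) 1 (by simp) (by simp)

/-! ### Adjoining one generator to O, and detecting like elements -/

theorem x_swap_mem_onsager : x F 2 1 ∈ onsager F ∧ x F 3 0 ∈ onsager F := by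
  rw [x_swap F 1 2 (by decide), x_swap F 0 3 (by decide)]
  exact ⟨neg_mem (x_mem_onsager F).1, neg_mem (x_mem_onsager F).2⟩

/-- Every `x_{pq}` either belongs to the Onsager subalgebra or has one index in common with each of
`x_{12}` and `x_{03}`. -/
theorem x_mem_onsager_or (p q : Fin 4) (hpq : p ≠ q) : x F p q hpq ∈ onsager F ∨
    (p = 1 ∨ p = 2 ∨ q = 1 ∨ q = 2) ∧ (p = 0 ∨ p = 3 ∨ q = 0 ∨ q = 3) := by
  fin_cases p <;> fin_cases q <;>
    first
    | exact absurd rfl hpq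
    | exact .inl (x_mem_onsager F).1
    | exact .inl (x_mem_onsager F).2
    | exact .inl (x_swap_mem_onsager F).1
    | exact .inl (x_swap_mem_onsager F).2
    | exact .inr (by decide)

/-- The space spanned by the Onsager subalgebra and one generator. -/
def onsagerSup (p q : Fin 4) (hpq : p ≠ q) : Submodule F (Tet F) :=
  (onsager F).toSubmodule ⊔ Submodule.span F {x F p q hpq}

theorem mem_onsagerSup {p q : Fin 4} {hpq : p ≠ q} {ξ : Tet F} :
    ξ ∈ onsagerSup F p q hpq ↔ ∃ η ∈ onsager F, ∃ c : F, ξ = η + c • x F p q hpq := by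
  simp only [onsagerSup, Submodule.mem_sup, Submodule.mem_span_singleton]
  constructor
  · rintro ⟨η, hη, _, ⟨c, rfl⟩, rfl⟩
    exact ⟨η, hη, c, rfl⟩
  · rintro ⟨η, hη, c, rfl⟩
    exact ⟨η, hη, _, ⟨c, rfl⟩, rfl⟩

theorem mem_onsagerSup_of_mem (p q : Fin 4) (hpq : p ≠ q) {ξ : Tet F} (h : ξ ∈ onsager F) :
    ξ ∈ onsagerSup F p q hpq :=
  Submodule.mem_sup_left (T := Submodule.span F {x F p q hpq}) h

/-- If x_{pq} is not in O, its brackets with x_{12} and x_{03} lie in the span of the two factors;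
the elements of O sent into O + F x_{pq} form a subalgebra, because ad x_{pq} is a derivation. -/
theorem lie_mem_onsagerSup (p q : Fin 4) (hpq : p ≠ q) {ξ : Tet F}
    (h : ξ ∈ onsagerSup F p q hpq) : ⁅x F p q hpq, ξ⁆ ∈ onsagerSup F p q hpq := by
  obtain ⟨η, hη, c, rfl⟩ := (mem_onsagerSup F).1 h
  rw [lie_add, lie_smul, lie_self, smul_zero, add_zero]
  clear h
  rcases x_mem_onsager_or F p q hpq with hx | ⟨h1, h2⟩
  · exact mem_onsagerSup_of_mem F p q hpq ((onsager F).lie_mem hx hη)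
  have hx : x F p q hpq ∈ onsagerSup F p q hpq :=
    (mem_onsagerSup F).2 ⟨0, zero_mem _, 1, by simp⟩
  induction hη using LieSubalgebra.lieSpan_induction with
  | mem ξ hξ =>
    obtain rfl | rfl := hξ
    · obtain ⟨c, d, h⟩ := exists_lie_x_eq F p q 1 2 hpq (by decide) h1
      rw [h]
      exact add_mem (Submodule.smul_mem _ _ hx)
        (Submodule.smul_mem _ _ (mem_onsagerSup_of_mem F p q hpq (x_mem_onsager F).1))
    · obtain ⟨c, d, h⟩ := exists_lie_x_eq F p q 0 3 hpq (by decide) h2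
      rw [h]
      exact add_mem (Submodule.smul_mem _ _ hx)
        (Submodule.smul_mem _ _ (mem_onsagerSup_of_mem F p q hpq (x_mem_onsager F).2))
  | zero => rw [lie_zero]; exact zero_mem _
  | add a b _ _ ha hb => rw [lie_add]; exact add_mem ha hb
  | smul c a _ ha => rw [lie_smul]; exact Submodule.smul_mem _ _ ha
  | lie a b ha' hb' ha hb =>
    obtain ⟨η, hη, c, h⟩ := (mem_onsagerSup F).1 ha
    obtain ⟨θ, hθ, d, h'⟩ := (mem_onsagerSup F).1 hb
    rw [leibniz_lie, h, h', add_lie, lie_add, smul_lie, lie_smul, ← lie_skew a (x F p q hpq)]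
    exact add_mem
      (add_mem (mem_onsagerSup_of_mem F p q hpq ((onsager F).lie_mem hη hb'))
        (Submodule.smul_mem _ _ hb))
      (add_mem (mem_onsagerSup_of_mem F p q hpq ((onsager F).lie_mem ha' hθ))
        (Submodule.smul_mem _ _ (neg_mem ha)))

variable [CharZero F]

/-- A generator `x_{pq}` whose image lies in the image of the Onsager subalgebra lies in the Onsager
subalgebra. -/
theorem x_mem_onsager_of_sigma_eq (p q : Fin 4) (hpq : p ≠ q) {ξ : Tet F} (h : ξ ∈ onsager F)
    (hσ : sigma F ξ = loopGen F p q) : x F p q hpq ∈ onsager F := by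
  obtain ⟨a, b, c, habc⟩ := exists_sigma_eq_comb F h
  obtain ⟨h1, h2, h3, h4, h5, h6, h7, h8, h9, h10, h11, h12⟩ := loopGen_values F
  obtain ⟨e1, e2⟩ := t_mul F
  have e3 : t' F = 1 - Ring.inverse (t F) := rfl
  have e4 : t'' F = Ring.inverse (1 - t F) := rfl
  obtain ⟨na1, na2, na3, na4⟩ := t_mul_ne_one F a
  obtain ⟨nb1, nb2, -, -⟩ := t_mul_ne_one F b
  obtain ⟨-, -, nc3, nc4⟩ := t_mul_ne_one F c
  rw [habc] at hσ
  clear habc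
  fin_cases p <;> fin_cases q <;>
    simp only [Fin.reduceFinMk, Fin.zero_eta, Fin.mk_one, Fin.isValue, h1, h2, h3, h4, h5, h6,
      h7, h8, h9, h10, h11, h12, comb_inj] at hσ
  · exact absurd rfl hpq
  -- For x_{01} the first coordinate would make t' - 1 = -t⁻¹ a polynomial. For x_{02} it is t'' =
  -- (1-t)⁻¹, and for x_{23}, x_{31} a coordinate 1 would be divisible by t or t - 1; the reversed
  -- pairs are similar.
  · refine absurd ?_ na2
    rw [hσ.1, e3]; linear_combination -e1
  · refine absurd ?_ na4
    rw [hσ.1, e4]; linear_combination -e2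
  · exact (x_mem_onsager F).2
  · refine absurd ?_ na1
    rw [hσ.1, e3]; linear_combination e1
  · exact absurd rfl hpq
  · exact (x_mem_onsager F).1
  · exact absurd hσ.2.2 nc4
  · refine absurd ?_ na3
    rw [hσ.1, e4]; linear_combination e2
  · exact (x_swap_mem_onsager F).1
  · exact absurd rfl hpq
  · exact absurd hσ.2.1 nb1
  · exact (x_swap_mem_onsager F).2
  · exact absurd hσ.2.2 nc3
  · exact absurd hσ.2.1 nb2
  · exact absurd rfl hpq

/-- A kernel element with c ≠ 0 would put the image of x_{pq} into that of O, hence x_{pq} into O,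
where `sigma` is injective. -/
theorem eq_zero_of_mem_onsagerSup (p q : Fin 4) (hpq : p ≠ q) {ξ : Tet F}
    (h : ξ ∈ onsagerSup F p q hpq) (h0 : sigma F ξ = 0) : ξ = 0 := by
  obtain ⟨η, hη, c, rfl⟩ := (mem_onsagerSup F).1 h
  refine eq_zero_of_sigma_eq_zero F (add_mem hη ?_) h0
  rcases eq_or_ne c 0 with rfl | hc
  · rw [zero_smul]; exact zero_mem _
  refine (onsager F).smul_mem c <| x_mem_onsager_of_sigma_eq F p q hpq
    (ξ := -(c⁻¹ • η)) (neg_mem ((onsager F).smul_mem _ hη)) ?_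
  rw [map_add, map_smul, sigma_x] at h0
  rw [map_neg, map_smul, eq_neg_of_add_eq_zero_left h0, smul_neg, neg_neg, smul_smul,
    inv_mul_cancel₀ hc, one_smul]

/-- For an element of the Onsager subalgebra, to be `x_{ij}`-like is seen in the loop algebra. -/
theorem mem_X_iff (i j : Fin 4) (hij : i ≠ j) {ξ : Tet F} (h : ξ ∈ onsager F) :
    ξ ∈ X F i j hij ↔ ⁅loopGen F i j, sigma F ξ⁆ = 0 := by
  constructor
  · rintro ⟨h1, -⟩
    rw [← sigma_x F i j hij, ← LieHom.map_lie, h1, map_zero]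
  intro h0
  refine ⟨eq_zero_of_mem_onsagerSup F i j hij (lie_mem_onsagerSup F i j hij
    (mem_onsagerSup_of_mem F i j hij h)) (by rw [LieHom.map_lie, sigma_x, h0]), ?_⟩
  intro p k hkp _ _ _ _
  have h1 := lie_mem_onsagerSup F k p hkp (mem_onsagerSup_of_mem F k p hkp h)
  have h2 := lie_mem_onsagerSup F k p hkp (lie_mem_onsagerSup F k p hkp h1)
  -- The defect of the cubic relation lies in O + F x_{kp}, and its image vanishes by
  -- `comb_dolanGrady`, whatever ξ is.
  refine sub_eq_zero.1 (eq_zero_of_mem_onsagerSup F k p hkp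
    (sub_mem h2 (Submodule.smul_mem _ 4 h1)) ?_)
  obtain ⟨a, b, c, habc⟩ := exists_sigma_eq_comb F h
  obtain ⟨a', b', c', habc', hq⟩ := loopGen_norm F k p hkp
  rw [map_sub, map_smul, LieHom.map_lie, LieHom.map_lie, LieHom.map_lie, sigma_x, habc, habc',
    comb_dolanGrady F _ _ _ _ _ _ hq, sub_self]

/-! ### The image of O as an F[t]-module -/

theorem exists_sigma_eq_t_smul {ξ : Tet F} (h : ξ ∈ onsager F) :
    ∃ η ∈ onsager F, sigma F η = t F • sigma F ξ := by
  obtain ⟨h1, -, -, -, -, -, h7, -⟩ := loopGen_values F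
  have hA := (x_mem_onsager F).1
  have hB := (x_mem_onsager F).2
  obtain ⟨C, hC, hσC⟩ : ∃ C ∈ onsager F, sigma F C = comb F 0 0 (t F - 1) := by
    -- The bracket has image (2, 2t, -2(t-1)), differing from twice the sum of the generators only
    -- in the sign of the last coordinate.
    refine ⟨(4 : F)⁻¹ • ((2 : F) • x F 1 2 + (2 : F) • x F 0 3 - ⁅x F 1 2, x F 0 3⁆),
      (onsager F).smul_mem _ (sub_mem (add_mem ((onsager F).smul_mem _ hA)
        ((onsager F).smul_mem _ hB)) ((onsager F).lie_mem hA hB)), ?_⟩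
    rw [map_smul, inv_smul_eq_iff₀ (by norm_num)]
    simp only [map_sub, map_add, map_smul, LieHom.map_lie, sigma_x, h1, h7, comb_lie, comb_two,
      comb_four, comb_add, comb_sub]
    congr 1 <;> ring
  induction h using LieSubalgebra.lieSpan_induction with
  | mem ξ hξ =>
    obtain rfl | rfl := hξ
    -- Half the bracket has image (t-1, 0, t-1), so the total is (t, 0, 0). For x_{03} it is (0,
    -- t(t-1), t(t-1)), and the total is (0, t², t(t-1)).
    · refine ⟨x F 1 2 - C + (2 : F)⁻¹ • ⁅C, x F 1 2⁆, add_mem (sub_mem hA hC)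
        ((onsager F).smul_mem _ ((onsager F).lie_mem hC hA)), ?_⟩
      apply smul_right_injective (Loop F) (two_ne_zero : (2 : F) ≠ 0)
      simp only [smul_add, map_sub, map_add, map_smul, LieHom.map_lie, sigma_x, h1, hσC,
        comb_lie, smul_inv_smul₀ (two_ne_zero : (2 : F) ≠ 0), smul_comb, comb_two, comb_add,
        comb_sub]
      congr 1 <;> ring
    · refine ⟨x F 0 3 - C + (2 : F)⁻¹ • ⁅x F 0 3, C⁆, add_mem (sub_mem hB hC)
        ((onsager F).smul_mem _ ((onsager F).lie_mem hB hC)), ?_⟩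
      apply smul_right_injective (Loop F) (two_ne_zero : (2 : F) ≠ 0)
      simp only [smul_add, map_sub, map_add, map_smul, LieHom.map_lie, sigma_x, h7, hσC,
        comb_lie, smul_inv_smul₀ (two_ne_zero : (2 : F) ≠ 0), smul_comb, comb_two, comb_add,
        comb_sub]
      congr 1 <;> ring
  | zero => exact ⟨0, zero_mem _, by simp⟩
  | add a b _ _ ha hb =>
    obtain ⟨a', ha', ha⟩ := ha
    obtain ⟨b', hb', hb⟩ := hb
    exact ⟨a' + b', add_mem ha' hb', by rw [map_add, map_add, ha, hb, smul_add]⟩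
  | smul c a _ ha =>
    obtain ⟨a', ha', ha⟩ := ha
    exact ⟨c • a', (onsager F).smul_mem c ha', by rw [map_smul, map_smul, ha, smul_comm]⟩
  | lie a b ha' _ _ hb =>
    obtain ⟨b', hb', hb⟩ := hb
    exact ⟨⁅a, b'⁆, (onsager F).lie_mem ha' hb', by
      rw [LieHom.map_lie, LieHom.map_lie, hb, lie_smul]⟩

theorem exists_sigma_eq_smul (p : F[X]) {ξ : Tet F} (h : ξ ∈ onsager F) :
    ∃ η ∈ onsager F, sigma F η = algebraMap F[X] (LaurentA F) p • sigma F ξ := by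
  induction p using Polynomial.induction_on with
  | C a =>
    refine ⟨a • ξ, (onsager F).smul_mem a h, ?_⟩
    rw [map_smul, ← Polynomial.algebraMap_eq, ← IsScalarTower.algebraMap_apply, algebraMap_smul]
  | add p q hp hq =>
    obtain ⟨a', ha', ha⟩ := hp
    obtain ⟨b', hb', hb⟩ := hq
    exact ⟨a' + b', add_mem ha' hb', by rw [map_add, map_add, ha, hb, add_smul]⟩
  | monomial n a ih =>
    obtain ⟨a', ha', ha⟩ := ih
    obtain ⟨b', hb', hb⟩ := exists_sigma_eq_t_smul F ha'
    refine ⟨b', hb', ?_⟩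
    rw [hb, ha, smul_smul]
    congr 1
    rw [pow_succ', mul_left_comm, map_mul _ Polynomial.X]
    rfl

end Image

end Tetrahedron

namespace Tetrahedron

/-! ### Criteria for direct sums -/

section DirectSums

variable {K V : Type*} [Field K] [AddCommGroup V] [Module K V]

theorem isDirectSum_iff {W : Submodule K V} {U : Fin 3 → Submodule K V} :
    IsDirectSum W U ↔ (∀ m, U m ≤ W) ∧
      (∀ w ∈ W, ∃ u : Fin 3 → V, (∀ m, u m ∈ U m) ∧ ∑ m, u m = w) ∧
      ∀ u : Fin 3 → V, (∀ m, u m ∈ U m) → ∑ m, u m = 0 → u = 0 := by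
  classical
  refine and_congr_right fun hle => ?_
  have hcoe : ∀ v : DirectSum (Fin 3) fun m => (U m).submoduleOf W,
      ((DirectSum.coeAddMonoidHom (fun m => (U m).submoduleOf W) v : W) : V) =
        ∑ m, ((v m : W) : V) := by
    intro v
    rw [DirectSum.coeAddMonoidHom_eq_dfinsuppSum, DFinsupp.sum_eq_sum_fintype _ (fun _ => rfl)]
    simp
  have hmk : ∀ u : Fin 3 → V, (∀ m, u m ∈ U m) →
      ∃ v : DirectSum (Fin 3) fun m => (U m).submoduleOf W, ∀ m, ((v m : W) : V) = u m :=
    fun u hu => ⟨DFinsupp.equivFunOnFintype.symm fun m => ⟨⟨u m, hle m (hu m)⟩, hu m⟩,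
      fun _ => rfl⟩
  unfold DirectSum.IsInternal
  constructor
  · rintro ⟨hinj, hsurj⟩
    refine ⟨fun w hw => ?_, fun u hu h0 => ?_⟩
    · obtain ⟨v, hv⟩ := hsurj ⟨w, hw⟩
      exact ⟨fun m => ((v m : W) : V), fun m => (v m).2, by rw [← hcoe, hv]⟩
    · obtain ⟨v, hvu⟩ := hmk u hu
      have hv : v = 0 := (injective_iff_map_eq_zero _).1 hinj v <| Subtype.ext <| by
        rw [hcoe, Finset.sum_congr rfl fun m _ => hvu m, h0, Submodule.coe_zero]
      funext m
      rw [← hvu, hv]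
      rfl
  · rintro ⟨hsum, hzero⟩
    refine ⟨(injective_iff_map_eq_zero _).2 fun v hv => ?_, fun w => ?_⟩
    · have h := hzero (fun m => ((v m : W) : V)) (fun m => (v m).2) (by
        rw [← hcoe, hv, Submodule.coe_zero])
      refine DFinsupp.ext fun m => Subtype.ext (Subtype.ext ?_)
      exact congrFun h m
    · obtain ⟨u, hu, hw⟩ := hsum w w.2
      obtain ⟨v, hvu⟩ := hmk u hu
      exact ⟨v, Subtype.ext (by rw [hcoe, ← hw, Finset.sum_congr rfl fun m _ => hvu m])⟩

theorem IsDirectSum.map {V' : Type*} [AddCommGroup V'] [Module K V'] {W : Submodule K V}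
    {U : Fin 3 → Submodule K V} (h : IsDirectSum W U) (f : V →ₗ[K] V')
    (hf : ∀ w ∈ W, f w = 0 → w = 0) : IsDirectSum (W.map f) fun m => (U m).map f := by
  rw [isDirectSum_iff] at h ⊢
  obtain ⟨hle, hsum, hzero⟩ := h
  refine ⟨fun m => Submodule.map_mono (hle m), ?_, fun u hu h0 => ?_⟩
  · rintro _ ⟨w, hw, rfl⟩
    obtain ⟨u, hu, rfl⟩ := hsum w hw
    exact ⟨fun m => f (u m), fun m => ⟨u m, hu m, rfl⟩, (map_sum f _ _).symm⟩
  · choose v hv hvu using hu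
    have : v = 0 := hzero v hv <| hf _ (sum_mem fun m _ => hle m (hv m)) <| by
      rw [map_sum, ← h0]
      exact Finset.sum_congr rfl fun m _ => hvu m
    funext m
    rw [← hvu m, this, Pi.zero_apply, map_zero, Pi.zero_apply]

end DirectSums

/-! ### The action of the group `G` -/

section Action

variable (F : Type*) [Field F]

theorem permHom_apply_mem_X (β : Equiv.Perm (Fin 4)) (i j : Fin 4) (hij : i ≠ j) {ξ : Tet F}
    (h : ξ ∈ X F i j hij) : permHom F β ξ ∈ X F (β i) (β j) (β.injective.ne hij) := by
  refine ⟨?_, fun h' k' hkh h1 h2 h3 h4 => ?_⟩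
  · rw [← permHom_x F β i j hij, ← LieHom.map_lie, h.1, map_zero]
  · obtain ⟨k, rfl⟩ := β.surjective k'
    obtain ⟨l, rfl⟩ := β.surjective h'
    have hkl : k ≠ l := fun h => hkh (congrArg β h)
    rw [← permHom_x F β k l hkl, ← LieHom.map_lie, ← LieHom.map_lie, ← LieHom.map_lie,
      h.2 l k hkl (fun h => h1 (congrArg β h)) (fun h => h2 (congrArg β h))
        (fun h => h3 (congrArg β h)) (fun h => h4 (congrArg β h)), map_smul]

theorem mem_onsager_of_generators {L : Type*} [LieRing L] [LieAlgebra F L] (f : Tet F →ₗ⁅F⁆ L)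
    (S : LieSubalgebra F L) (h1 : f (x F 1 2) ∈ S) (h2 : f (x F 0 3) ∈ S) {ξ : Tet F}
    (h : ξ ∈ onsager F) : f ξ ∈ S := by
  have hle : onsager F ≤ S.comap f := LieSubalgebra.lieSpan_le.2 (by
    rintro _ (rfl | rfl)
    · exact h1
    · exact h2)
  exact hle h

/-- The permutations `β` such that `β` and its inverse preserve the Onsager subalgebra. -/
def onsagerStabilizer : Subgroup (Equiv.Perm (Fin 4)) where
  carrier := {β | ∀ ξ, permHom F β ξ ∈ onsager F ↔ ξ ∈ onsager F}
  one_mem' ξ := by rw [permHom_one, LieHom.id_apply]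
  mul_mem' {β γ} hβ hγ ξ := by rw [← permHom_comp, LieHom.comp_apply, hβ, hγ]
  inv_mem' {β} hβ ξ := by
    rw [← hβ, ← LieHom.comp_apply, permHom_comp, mul_inv_cancel, permHom_one, LieHom.id_apply]

/-- For an involution, the inclusion β(O) ⊆ O applied twice gives the converse. -/
theorem mem_onsagerStabilizer_of_mul_self {β : Equiv.Perm (Fin 4)} (hβ : β * β = 1)
    (h1 : permHom F β (x F 1 2) ∈ onsager F) (h2 : permHom F β (x F 0 3) ∈ onsager F) :
    β ∈ onsagerStabilizer F := by
  have h : ∀ ξ ∈ onsager F, permHom F β ξ ∈ onsager F := fun ξ hξ =>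
    mem_onsager_of_generators F (permHom F β) (onsager F) h1 h2 hξ
  refine fun ξ => ⟨fun hξ => ?_, h ξ⟩
  have := h _ hξ
  rwa [← LieHom.comp_apply, permHom_comp, hβ, permHom_one, LieHom.id_apply] at this

theorem kleinG_le_onsagerStabilizer : kleinG ≤ onsagerStabilizer F := by
  refine (Subgroup.closure_le _).2 ?_
  rintro _ (rfl | rfl)
  · refine mem_onsagerStabilizer_of_mul_self F (by decide) ?_ ?_ <;> rw [permHom_x]
    · exact (x_swap_mem_onsager F).1
    · exact (x_swap_mem_onsager F).2
  · refine mem_onsagerStabilizer_of_mul_self F (by decide) ?_ ?_ <;> rw [permHom_x]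
    · exact (x_swap_mem_onsager F).1
    · exact (x_mem_onsager F).2

theorem map_permAut_onsager {β : Equiv.Perm (Fin 4)} (hβ : β ∈ kleinG) :
    (onsager F).map (permAut F β : Tet F →ₗ⁅F⁆ Tet F) = onsager F := by
  have h := kleinG_le_onsagerStabilizer F hβ
  ext ξ
  rw [LieSubalgebra.mem_map]
  constructor
  · rintro ⟨η, hη, rfl⟩
    exact (h η).2 hη
  · intro hξ
    refine ⟨(permAut F β).symm ξ, (h _).1 ?_, (permAut F β).apply_symm_apply ξ⟩
    exact ((permAut F β).apply_symm_apply ξ).symm ▸ hξ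

theorem map_permAut_X_inf_onsager {β : Equiv.Perm (Fin 4)} (hβ : β ∈ kleinG) (i j i' j' : Fin 4)
    (hij : i ≠ j) (hij' : i' ≠ j') (hi : β i = i') (hj : β j = j') :
    (X F i j hij ⊓ (onsager F).toSubmodule).map (permAut F β).toLinearEquiv.toLinearMap =
      X F i' j' hij' ⊓ (onsager F).toSubmodule := by
  subst hi hj
  have h := kleinG_le_onsagerStabilizer F hβ
  ext ξ
  constructor
  · rintro ⟨η, ⟨hη, hη'⟩, rfl⟩
    exact ⟨permHom_apply_mem_X F β i j hij hη, (h η).2 hη'⟩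
  · rintro ⟨hξ, hξ'⟩
    refine ⟨(permAut F β).symm ξ, ⟨?_, (h _).1 ?_⟩, (permAut F β).apply_symm_apply ξ⟩
    · have := permHom_apply_mem_X F β⁻¹ _ _ hij' hξ
      have hcast : ∀ (i' j' : Fin 4) (hij' : i' ≠ j') (η : Tet F), i' = i → j' = j →
          η ∈ X F i' j' hij' → η ∈ X F i j hij := by
        rintro _ _ _ _ rfl rfl h
        exact h
      exact hcast _ _ _ _ (β.symm_apply_apply i) (β.symm_apply_apply j) this
    · exact ((permAut F β).apply_symm_apply ξ).symm ▸ hξ'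

theorem rho_mem_kleinG : rho ∈ kleinG := Subgroup.subset_closure (.inl rfl)

theorem tau_mem_kleinG : tau ∈ kleinG := Subgroup.subset_closure (.inr rfl)

theorem map_pathSummands {β : Equiv.Perm (Fin 4)} (hβ : β ∈ kleinG) {k h i j k' h' i' j' : Fin 4}
    (hkh : k ≠ h) (hhi : h ≠ i) (hij : i ≠ j) (hkh' : k' ≠ h') (hhi' : h' ≠ i') (hij' : i' ≠ j')
    (ek : β k = k') (eh : β h = h') (ei : β i = i') (ej : β j = j') (m : Fin 3) :
    (pathSummands F k h i j hkh hhi hij m).map (permAut F β).toLinearEquiv.toLinearMap =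
      pathSummands F k' h' i' j' hkh' hhi' hij' m := by
  fin_cases m
  · exact map_permAut_X_inf_onsager F hβ _ _ _ _ _ _ ek eh
  · exact map_permAut_X_inf_onsager F hβ _ _ _ _ _ _ eh ei
  · exact map_permAut_X_inf_onsager F hβ _ _ _ _ _ _ ei ej

theorem IsDirectSum.map_permAut {β : Equiv.Perm (Fin 4)} (hβ : β ∈ kleinG)
    {U U' : Fin 3 → Submodule F (Tet F)} (h : IsDirectSum (onsager F).toSubmodule U)
    (hU : ∀ m, (U m).map (permAut F β).toLinearEquiv.toLinearMap = U' m) :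
    IsDirectSum (onsager F).toSubmodule U' := by
  have h2 := h.map (permAut F β).toLinearEquiv.toLinearMap
    fun w _ hw => (permAut F β).toLinearEquiv.map_eq_zero_iff.1 hw
  have e : (onsager F).toSubmodule.map (permAut F β).toLinearEquiv.toLinearMap =
      (onsager F).toSubmodule :=
    congrArg LieSubalgebra.toSubmodule (map_permAut_onsager F hβ)
  rwa [e, funext hU] at h2

theorem nonempty_kleinG_mulEquiv :
    Nonempty (kleinG ≃* Multiplicative (ZMod 2) × Multiplicative (ZMod 2)) := by
  let f : Multiplicative (ZMod 2) × Multiplicative (ZMod 2) →* Equiv.Perm (Fin 4) :=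
    MonoidHom.mk' (fun w => rho ^ (Multiplicative.toAdd w.1).val *
      tau ^ (Multiplicative.toAdd w.2).val) (by decide)
  have hf : Function.Injective f := by
    have : ∀ a b : Multiplicative (ZMod 2) × Multiplicative (ZMod 2), f a = f b → a = b := by decide
    exact fun a b => this a b
  have hrange : f.range = kleinG := by
    apply le_antisymm
    · rintro _ ⟨w, rfl⟩
      exact mul_mem (pow_mem rho_mem_kleinG _) (pow_mem tau_mem_kleinG _)
    · refine (Subgroup.closure_le _).2 ?_
      rintro _ (rfl | rfl)
      · exact ⟨(Multiplicative.ofAdd 1, 1), by decide⟩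
      · exact ⟨(1, Multiplicative.ofAdd 1), by decide⟩
  exact ⟨((MonoidHom.ofInjective hf).trans (MulEquiv.subgroupCongr hrange)).symm⟩

/-! ### The decompositions -/

variable [CharZero F]

theorem isDirectSum_pathSummands :
    IsDirectSum (onsager F).toSubmodule (pathSummands F 0 3 1 2) := by
  obtain ⟨h1, -, -, -, h5, -, h7, -⟩ := loopGen_values F
  rw [isDirectSum_iff]
  refine ⟨fun m => ?_, fun ξ hξ => ?_, fun u hu h0 => ?_⟩
  · fin_cases m <;> exact inf_le_right
  · obtain ⟨p, q, r, hpqr⟩ := exists_sigma_eq_comb F hξ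
    obtain ⟨a, ha, hσa⟩ := exists_sigma_eq_smul F q (x_mem_onsager F).2
    obtain ⟨b, hb, hσb⟩ := exists_sigma_eq_smul F p (x_mem_onsager F).1
    rw [sigma_x, h7, smul_comb] at hσa
    rw [sigma_x, h1, smul_comb] at hσb
    -- With q and p as multipliers, a and b absorb the second and first coordinates of ξ. What
    -- remains is a multiple of the image of x_{31}, and it lies in O because it is a difference.
    have hc : ξ - a - b ∈ onsager F := sub_mem (sub_mem hξ ha) hb
    have hσc : sigma F (ξ - a - b) =
        comb F 0 0 ((t F - 1) * (algebraMap _ _ r - algebraMap _ _ q)) := by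
      rw [map_sub, map_sub, hpqr, hσa, hσb, comb_sub, comb_sub]
      congr 1 <;> ring
    refine ⟨![a, ξ - a - b, b], fun m => ?_, ?_⟩
    · fin_cases m
      · refine ⟨(mem_X_iff F 0 3 (by decide) ha).2 ?_, ha⟩
        rw [hσa, h7, comb_lie, ← comb_zero F]
        congr 1 <;> ring
      · refine ⟨(mem_X_iff F 3 1 (by decide) hc).2 ?_, hc⟩
        rw [hσc, h5, comb_lie, ← comb_zero F]
        congr 1 <;> ring
      · refine ⟨(mem_X_iff F 1 2 (by decide) hb).2 ?_, hb⟩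
        rw [hσb, h1, comb_lie, ← comb_zero F]
        congr 1 <;> ring
    · simp only [Fin.sum_univ_three, Matrix.cons_val]
      abel
  · have ha := hu 0
    have hc := hu 1
    have hb := hu 2
    simp only [pathSummands, Matrix.cons_val, Submodule.mem_inf,
      LieSubalgebra.mem_toSubmodule] at ha hb hc
    have ea := (mem_X_iff F 0 3 (by decide) ha.2).1 ha.1
    have ec := (mem_X_iff F 3 1 (by decide) hc.2).1 hc.1
    have eb := (mem_X_iff F 1 2 (by decide) hb.2).1 hb.1
    obtain ⟨a₁, a₂, a₃, ha'⟩ := exists_sigma_eq_comb F ha.2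
    obtain ⟨b₁, b₂, b₃, hb'⟩ := exists_sigma_eq_comb F hb.2
    obtain ⟨c₁, c₂, c₃, hc'⟩ := exists_sigma_eq_comb F hc.2
    have h0' := congrArg (sigma F) h0
    rw [Fin.sum_univ_three, map_add, map_add, ha', hb', hc', map_zero] at h0'
    rw [ha', h7] at ea
    rw [hb', h1] at eb
    rw [hc', h5] at ec
    simp only [comb_lie, comb_add, comb_eq_zero] at ea eb ec h0'
    generalize algebraMap F[X] (LaurentA F) a₁ = a₁ at *
    generalize t F * algebraMap F[X] (LaurentA F) a₂ = a₂ at *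
    generalize (t F - 1) * algebraMap F[X] (LaurentA F) a₃ = a₃ at *
    generalize algebraMap F[X] (LaurentA F) b₁ = b₁ at *
    generalize t F * algebraMap F[X] (LaurentA F) b₂ = b₂ at *
    generalize (t F - 1) * algebraMap F[X] (LaurentA F) b₃ = b₃ at *
    generalize algebraMap F[X] (LaurentA F) c₁ = c₁ at *
    generalize t F * algebraMap F[X] (LaurentA F) c₂ = c₂ at *
    generalize (t F - 1) * algebraMap F[X] (LaurentA F) c₃ = c₃ at *
    obtain ⟨ea1, ea2, ea3⟩ := ea
    obtain ⟨eb1, eb2, eb3⟩ := eb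
    obtain ⟨ec1, ec2, ec3⟩ := ec
    obtain ⟨s1, s2, s3⟩ := h0'
    -- The commutation relations make the three images proportional to (0, t, t-1), (1, 0, 0) and
    -- (0, 0, 1), which are independent because t is a unit.
    have cancel : ∀ {a : LaurentA F}, 2 * a = 0 → a = 0 := (isUnit_two F).mul_right_eq_zero.1
    have ka1 : a₁ = 0 := cancel (by linear_combination -ea1)
    have kb2 : b₂ = 0 := cancel (by linear_combination eb2)
    have kb3 : b₃ = 0 := cancel (by linear_combination -eb3)
    have kc1 : c₁ = 0 := cancel (by linear_combination ec1)
    have kc2 : c₂ = 0 := cancel (by linear_combination -ec2)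
    have kb1 : b₁ = 0 := by linear_combination s1 - ka1 - kc1
    have ka2 : a₂ = 0 := by linear_combination s2 - kb2 - kc2
    have ka3 : a₃ = 0 := (isUnit_t F).1.mul_right_eq_zero.1 <| cancel (by
      linear_combination ea2 + 2 * t F * ka1 + 2 * (t F - 1) * ka2)
    have kc3 : c₃ = 0 := by linear_combination s3 - ka3 - kb3
    funext m
    fin_cases m
    · exact show u 0 = 0 from eq_zero_of_sigma_eq_zero F ha.2 (by
        rw [ha', ka1, ka2, ka3, comb_zero])
    · exact show u 1 = 0 from eq_zero_of_sigma_eq_zero F hc.2 (by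
        rw [hc', kc1, kc2, kc3, comb_zero])
    · exact show u 2 = 0 from eq_zero_of_sigma_eq_zero F hb.2 (by
        rw [hb', kb1, kb2, kb3, comb_zero])

/-- Injectivity of `sigma` on the whole tetrahedron algebra is not needed: if η in O and an
x_{ij}-like ξ have the same image, that image commutes with the image of x_{ij}, so η is x_{ij}-like
by `mem_X_iff`. -/
theorem map_sigma_X_inf (i j : Fin 4) (hij : i ≠ j) :
    (X F i j hij).map (sigma F : Tet F →ₗ[F] Loop F) ⊓
        ((onsager F).map (sigma F)).toSubmodule =
      (X F i j hij ⊓ (onsager F).toSubmodule).map (sigma F : Tet F →ₗ[F] Loop F) := by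
  ext v
  constructor
  · rintro ⟨⟨ξ, hξ, rfl⟩, η, hη, hηξ⟩
    have hηξ : sigma F η = sigma F ξ := hηξ
    refine ⟨η, ⟨(mem_X_iff F i j hij hη).2 ?_, hη⟩, hηξ⟩
    rw [hηξ, ← sigma_x F i j hij, ← LieHom.map_lie, hξ.1, map_zero]
  · rintro ⟨ξ, ⟨hξ, hξ'⟩, rfl⟩
    exact ⟨⟨ξ, hξ, rfl⟩, ξ, hξ', rfl⟩

theorem isDirectSum_pathSummandsLoop (k h i j : Fin 4) (hkh : k ≠ h) (hhi : h ≠ i) (hij : i ≠ j)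
    (hd : IsDirectSum (onsager F).toSubmodule (pathSummands F k h i j hkh hhi hij)) :
    IsDirectSum ((onsager F).map (sigma F)).toSubmodule
      (pathSummandsLoop F k h i j hkh hhi hij) := by
  have h2 := hd.map (sigma F : Tet F →ₗ[F] Loop F) fun w hw => eq_zero_of_sigma_eq_zero F hw
  have e : (fun m => (pathSummands F k h i j hkh hhi hij m).map
      (sigma F : Tet F →ₗ[F] Loop F)) = pathSummandsLoop F k h i j hkh hhi hij := by
    funext m
    fin_cases m <;> exact (map_sigma_X_inf F _ _ _).symm
  rwa [e] at h2

end Action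

end Tetrahedron

end

theorem mainTheorem2 (F : Type*) [Field F] [CharZero F] :
    -- the four decompositions of `O` in the tetrahedron algebra
    (Tetrahedron.IsDirectSum (Tetrahedron.onsager F).toSubmodule
        (Tetrahedron.pathSummands F 0 3 1 2) ∧
      Tetrahedron.IsDirectSum (Tetrahedron.onsager F).toSubmodule
        (Tetrahedron.pathSummands F 3 0 2 1) ∧
      Tetrahedron.IsDirectSum (Tetrahedron.onsager F).toSubmodule
        (Tetrahedron.pathSummands F 0 3 2 1) ∧
      Tetrahedron.IsDirectSum (Tetrahedron.onsager F).toSubmodule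
        (Tetrahedron.pathSummands F 3 0 1 2)) ∧
    -- the same decompositions for the images in the loop algebra
    (Tetrahedron.IsDirectSum ((Tetrahedron.onsager F).map (Tetrahedron.sigma F)).toSubmodule
        (Tetrahedron.pathSummandsLoop F 0 3 1 2) ∧
      Tetrahedron.IsDirectSum ((Tetrahedron.onsager F).map (Tetrahedron.sigma F)).toSubmodule
        (Tetrahedron.pathSummandsLoop F 3 0 2 1) ∧
      Tetrahedron.IsDirectSum ((Tetrahedron.onsager F).map (Tetrahedron.sigma F)).toSubmodule
        (Tetrahedron.pathSummandsLoop F 0 3 2 1) ∧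
      Tetrahedron.IsDirectSum ((Tetrahedron.onsager F).map (Tetrahedron.sigma F)).toSubmodule
        (Tetrahedron.pathSummandsLoop F 3 0 1 2)) ∧
    -- the group `G` is isomorphic to `ℤ₂ × ℤ₂` and leaves `O` invariant
    Nonempty (Tetrahedron.kleinG ≃* Multiplicative (ZMod 2) × Multiplicative (ZMod 2)) ∧
    (∀ β ∈ Tetrahedron.kleinG,
      (Tetrahedron.onsager F).map (Tetrahedron.permAut F β : Tetrahedron.Tet F →ₗ⁅F⁆ _) =
        Tetrahedron.onsager F) ∧
    -- `ρ`, `τ`, `ρτ` carry the first decomposition to the other three, summand by summand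
    (∀ m : Fin 3,
      ((Tetrahedron.pathSummands F 0 3 1 2) m).map
          (Tetrahedron.permAut F Tetrahedron.rho).toLinearEquiv.toLinearMap =
        (Tetrahedron.pathSummands F 3 0 2 1) m ∧
      ((Tetrahedron.pathSummands F 0 3 1 2) m).map
          (Tetrahedron.permAut F Tetrahedron.tau).toLinearEquiv.toLinearMap =
        (Tetrahedron.pathSummands F 0 3 2 1) m ∧
      ((Tetrahedron.pathSummands F 0 3 1 2) m).map
          (Tetrahedron.permAut F (Tetrahedron.rho * Tetrahedron.tau)).toLinearEquiv.toLinearMap =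
        (Tetrahedron.pathSummands F 3 0 1 2) m) := by
  have m1 := Tetrahedron.rho_mem_kleinG
  have m2 := Tetrahedron.tau_mem_kleinG
  have hρ := Tetrahedron.map_pathSummands F m1 (k := 0) (h := 3) (i := 1) (j := 2)
    (k' := 3) (h' := 0) (i' := 2) (j' := 1) (by decide) (by decide) (by decide) (by decide)
    (by decide) (by decide) (by decide) (by decide) (by decide) (by decide)
  have hτ := Tetrahedron.map_pathSummands F m2 (k := 0) (h := 3) (i := 1) (j := 2)
    (k' := 0) (h' := 3) (i' := 2) (j' := 1) (by decide) (by decide) (by decide) (by decide)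
    (by decide) (by decide) (by decide) (by decide) (by decide) (by decide)
  have hρτ := Tetrahedron.map_pathSummands F (mul_mem m1 m2) (k := 0) (h := 3) (i := 1) (j := 2)
    (k' := 3) (h' := 0) (i' := 1) (j' := 2) (by decide) (by decide) (by decide) (by decide)
    (by decide) (by decide) (by decide) (by decide) (by decide) (by decide)
  have d := Tetrahedron.isDirectSum_pathSummands F
  have d1 := d.map_permAut F m1 hρ
  have d2 := d.map_permAut F m2 hτ
  have d3 := d.map_permAut F (mul_mem m1 m2) hρτ
  exact ⟨⟨d, d1, d2, d3⟩,
    ⟨Tetrahedron.isDirectSum_pathSummandsLoop F _ _ _ _ _ _ _ d,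
      Tetrahedron.isDirectSum_pathSummandsLoop F _ _ _ _ _ _ _ d1,
      Tetrahedron.isDirectSum_pathSummandsLoop F _ _ _ _ _ _ _ d2,
      Tetrahedron.isDirectSum_pathSummandsLoop F _ _ _ _ _ _ _ d3⟩,
    Tetrahedron.nonempty_kleinG_mulEquiv,
    fun _ hβ => Tetrahedron.map_permAut_onsager F hβ,
    fun m => ⟨hρ m, hτ m, hρτ m⟩⟩
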